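/- Let $3\le p\le t+1$. A crossover design $d$ assigns to each of $n$ units $u$ in each of $p$ periods $k$ a treatment $d(k,u)\in\{0,1,\dots,t\}$, where $0$ is the control and $1,\dots,t$ are the test treatments. Let $n_{diu}$ be the number of times treatment $i$ is assigned to unit $u$, $\tilde n_{diu}$ the number of times this happens in the first $p-1$ periods, $l_{dik}$ the number of times $i$ is assigned to period $k$, $m_{dij}$ the number of times $i$ is immediately preceded by $j$ in the same unit, $r_{di}$ the total replication of $i$, $\tilde r_{di}$ its replication in the first $p-1$ periods, and $\hat r_{d0}$ the replication of the control in periods $2,\dots,p$. Consider the homoscedastic linear model $Y_d=\mu\mathbf 1+P\alpha+U\beta+T_d\tau+F_d\rho+e$ with observations indexed by (unit, period), where $P$ and $U$ are the period and unit incidence matrices, $T_d$ is the incidence matrix of the treatments, and $F_d$ is that of the treatments of the preceding period in the same unit (zero rows in period 1). Write $\mathrm{pr}^\perp(X)=I-X(X'X)^-X'$. Let $M_d$ be the information matrix of the contrast vector $(\tau_1-\tau_0,\dots,\tau_t-\tau_0)'$, that is, $M_d=(T_dV)'\,\mathrm{pr}^\perp([P|U|F_d])\,T_dV$ where $V$ is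 the $(t+1)\times t$ matrix consisting of a zero row on top of $I_t$. Suppose $0<\tilde r_{d0}<n(p-1)$, and set $$A=\sum_{i=1}^t\Big(m_{dii}-\tfrac1p\sum_{u=1}^n n_{diu}\tilde n_{diu}\Big),\qquad G=m_{d00}-\tfrac1p\sum_{u=1}^n n_{d0u}\tilde n_{d0u},$$ $$B=\hat r_{d0}-\tfrac{p-1}{p}r_{d0}-m_{d00}+\tfrac1p\sum_{u=1}^n n_{d0u}\tilde n_{d0u},$$ $$x_0=\frac{t\big(np-r_{d0}-\frac1p\sum_{u=1}^n\sum_{i=1}^t n_{diu}^2\big)-\big(r_{d0}-\frac1p\sum_{u=1}^n n_{d0u}^2\big)}{t(t-1)}-\frac{tp\,\big(A+\frac1t B\big)^2}{(t-1)\big[n(p-1)(pt-t-1)-(pt-t+p-2)\tilde r_{d0}+\sum_{u=1}^n\tilde n_{d0u}^2\big]},$$ $$y_0=\frac1t\Big(r_{d0}-\tfrac1p\sum_{u=1}^n n_{d0u}^2\Big)-\frac{p\,[n(p-1)-\tilde r_{d0}]\,G^2+p\,\tilde r_{d0}\,B^2}{t\big[np(p-1)\tilde r_{d0}-\tilde r_{d0}^2-n(p-1)\sum_{u=1}^n\tilde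 n_{d0u}^2\big]}.$$ If $M_d$ is nonsingular, then $x_0>0$, $y_0>0$ and $$\operatorname{Tr}(M_d^{-1})\ \ge\ \frac{t-1}{x_0}+\frac1{y_0}.$$ Suppose further that (i) $l_{dik}=r_{di}/p$ for all $i=0,\dots,t$ and $k=1,\dots,p$; (ii) $T_d'\mathrm{pr}^\perp(U)T_d$, $T_d'\mathrm{pr}^\perp(U)F_d$ and $F_d'\mathrm{pr}^\perp(U)F_d$ are invariant under every permutation of the test treatments (applied simultaneously to rows and columns, with the control fixed); (iii) each test treatment appears at most once in the first $p-1$ periods of each unit. Then $M_d$ is nonsingular if and only if $x_0>0$ and $y_0>0$, and in that case $\operatorname{Tr}(M_d^{-1})=\frac{t-1}{x_0}+\frac1{y_0}$. -/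

import Mathlib

open scoped Matrix

namespace Crossover

noncomputable section

/-- Every square real matrix has a generalized inverse. -/
theorem exists_ginv {κ : Type*} [Fintype κ] [DecidableEq κ] (A : Matrix κ κ ℝ) :
    ∃ G : Matrix κ κ ℝ, A * G * A = A := by
  obtain ⟨g, hg⟩ : ∃ g : (κ → ℝ) →ₗ[ℝ] (κ → ℝ),
      Matrix.toLin' A ∘ₗ g ∘ₗ Matrix.toLin' A = Matrix.toLin' A := by
    set f := Matrix.toLin' A
    obtain ⟨s, hs⟩ := f.rangeRestrict.exists_rightInverse_of_surjective f.range_rangeRestrict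
    obtain ⟨e, he⟩ := (LinearMap.range f).subtype.exists_leftInverse_of_injective
      (LinearMap.range f).ker_subtype
    refine ⟨s ∘ₗ e, ?_⟩
    ext1 i
    refine LinearMap.ext fun x => ?_
    have h1 : ∀ v, e (f v) = f.rangeRestrict v := fun v =>
      LinearMap.congr_fun he (f.rangeRestrict v)
    have h2 : ∀ w, f (s w) = w := fun w =>
      congrArg Subtype.val (LinearMap.congr_fun hs w)
    simp only [LinearMap.comp_apply, h1, h2]
    rfl
  refine ⟨LinearMap.toMatrix' g, Matrix.toLin'.injective ?_⟩
  rw [Matrix.toLin'_mul, Matrix.toLin'_mul, Matrix.toLin'_toMatrix']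
  exact hg

/-- A generalized inverse `A⁻` of `A`, i.e. a matrix with `A A⁻ A = A`. -/
def ginv {κ : Type*} [Fintype κ] [DecidableEq κ] (A : Matrix κ κ ℝ) : Matrix κ κ ℝ :=
  Classical.choose (exists_ginv A)

/-- `pr(X) = X (X'X)⁻ X'`, the orthogonal projector onto the column space of `X`. -/
def pr {ι κ : Type*} [Fintype ι] [Fintype κ] [DecidableEq κ]
    (X : Matrix ι κ ℝ) : Matrix ι ι ℝ :=
  X * ginv (Xᵀ * X) * Xᵀ

/-- `pr^⊥(X) = I - pr(X)`. -/
def prPerp {ι κ : Type*} [Fintype ι] [DecidableEq ι] [Fintype κ] [DecidableEq κ]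
    (X : Matrix ι κ ℝ) : Matrix ι ι ℝ :=
  1 - pr X

/-- The information matrix `X' pr^⊥(Z) X` for the parameter `θ` in the homoscedastic linear model
`Y = X θ + Z η + e`, the nuisance parameter being `η`. -/
def infoMatrix {ι κ ν : Type*} [Fintype ι] [DecidableEq ι] [Fintype ν] [DecidableEq ν]
    (X : Matrix ι κ ℝ) (Z : Matrix ι ν ℝ) : Matrix κ κ ℝ :=
  Xᵀ * prPerp Z * X

/-- A crossover design with `t` test treatments `1, …, t` and the control treatment `0`, with `p`
periods and `n` experimental units: `d k u` is the treatment given to unit `u` in period `k`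
(periods are numbered from `0` here). -/
abbrev Design (t n p : ℕ) : Type := Fin p → Fin n → Fin (t + 1)

variable {t n p : ℕ}

/-! ### Counting statistics -/

/-- `n_{diu}`: how often treatment `i` is assigned to unit `u`. -/
def nIU (d : Design t n p) (i : Fin (t + 1)) (u : Fin n) : ℕ :=
  (Finset.univ.filter fun k : Fin p => d k u = i).card

/-- `ñ_{diu}`: how often treatment `i` is assigned to unit `u` in the first `p - 1` periods. -/
def nTilde (d : Design t n p) (i : Fin (t + 1)) (u : Fin n) : ℕ :=
  (Finset.univ.filter fun k : Fin p => k.val + 1 < p ∧ d k u = i).card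

/-- `l_{dik}`: how often treatment `i` is assigned to period `k`. -/
def lIK (d : Design t n p) (i : Fin (t + 1)) (k : Fin p) : ℕ :=
  (Finset.univ.filter fun u : Fin n => d k u = i).card

/-- `m_{dij}`: how often treatment `i` is immediately preceded by treatment `j`. -/
def mIJ (d : Design t n p) (i j : Fin (t + 1)) : ℕ :=
  (Finset.univ.filter fun q : Fin p × Fin p × Fin n =>
    q.2.1.val + 1 = q.1.val ∧ d q.1 q.2.2 = i ∧ d q.2.1 q.2.2 = j).card

/-- `r_{di}`: the total replication of treatment `i`. -/
def rep (d : Design t n p) (i : Fin (t + 1)) : ℕ :=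
  (Finset.univ.filter fun q : Fin p × Fin n => d q.1 q.2 = i).card

/-- `r̃_{di}`: the replication of treatment `i` in the first `p - 1` periods. -/
def repTilde (d : Design t n p) (i : Fin (t + 1)) : ℕ :=
  (Finset.univ.filter fun q : Fin p × Fin n => q.1.val + 1 < p ∧ d q.1 q.2 = i).card

/-- `r̂_{d0}`: the replication of the control treatment in the periods `2, …, p`. -/
def repHat (d : Design t n p) : ℕ :=
  (Finset.univ.filter fun q : Fin p × Fin n => 0 < q.1.val ∧ d q.1 q.2 = 0).card

/-! ### The model `Y = μ 1 + P α + U β + T τ + F ρ + e`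

The observations are indexed by pairs (unit, period). -/

/-- `P = 1_n ⊗ I_p`, the incidence matrix of the periods. -/
def periodMat (n p : ℕ) : Matrix (Fin n × Fin p) (Fin p) ℝ :=
  Matrix.of fun q k => if q.2 = k then 1 else 0

/-- `U = I_n ⊗ 1_p`, the incidence matrix of the units. -/
def unitMat (n p : ℕ) : Matrix (Fin n × Fin p) (Fin n) ℝ :=
  Matrix.of fun q u => if q.1 = u then 1 else 0

/-- `T_d`, the incidence matrix of the direct effects. -/
def directMat (d : Design t n p) : Matrix (Fin n × Fin p) (Fin (t + 1)) ℝ :=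
  Matrix.of fun q i => if d q.2 q.1 = i then 1 else 0

/-- The `p × p` matrix `L` with ones just below the diagonal and zeros elsewhere. -/
def shiftMat (p : ℕ) : Matrix (Fin p) (Fin p) ℝ :=
  Matrix.of fun k k' => if k'.val + 1 = k.val then 1 else 0

/-- `F_d`, the incidence matrix of the carryover effects; its block for unit `u` is `L T_{du}`. -/
def carryMat (d : Design t n p) : Matrix (Fin n × Fin p) (Fin (t + 1)) ℝ :=
  Matrix.of fun q i => (shiftMat p * Matrix.of fun k' j => directMat d (q.1, k') j) q.2 i

/-- The partitioned matrix `[P | U | F_d]`. The all-ones column of the general mean is in the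
column space of `P`, so it need not be listed. -/
def nuisanceMat (d : Design t n p) :
    Matrix (Fin n × Fin p) ((Fin p ⊕ Fin n) ⊕ Fin (t + 1)) ℝ :=
  Matrix.fromCols (Matrix.fromCols (periodMat n p) (unitMat n p)) (carryMat d)

/-- `C_d`, the information matrix for the direct effects `(τ_0, …, τ_t)'`. -/
def infoDirect (d : Design t n p) : Matrix (Fin (t + 1)) (Fin (t + 1)) ℝ :=
  infoMatrix (directMat d) (nuisanceMat d)

/-- The `(t + 1) × t` matrix `V` whose first row is zero and whose other rows form `I_t`. -/
def contrastMat (t : ℕ) : Matrix (Fin (t + 1)) (Fin t) ℝ :=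
  Matrix.of fun i j => if i = j.succ then 1 else 0

/-- `M_d`, the information matrix for the contrast vector `θ = (τ_1 - τ_0, …, τ_t - τ_0)'`.
Since the rows of `T_d` sum to one, `T_d τ = τ_0 1 + T_d V θ`; thus `θ` is the parameter that
belongs to `T_d V` once `τ_0` has been absorbed into the general mean. -/
def infoContrast (d : Design t n p) : Matrix (Fin t) (Fin t) ℝ :=
  infoMatrix (directMat d * contrastMat t) (nuisanceMat d)

/-- `M_d = V' C_d V`. -/
theorem infoContrast_eq (d : Design t n p) :
    infoContrast d = (contrastMat t)ᵀ * infoDirect d * contrastMat t := by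
  simp only [infoContrast, infoDirect, infoMatrix, Matrix.transpose_mul, Matrix.mul_assoc]

/-- The rows of `T_d` sum to one, and `T_d τ = τ_0 1 + T_d V θ`. -/
theorem directMat_mulVec (d : Design t n p) (τ : Fin (t + 1) → ℝ) :
    directMat d *ᵥ τ = (fun _ => τ 0) +
      (directMat d * contrastMat t) *ᵥ (fun j : Fin t => τ j.succ - τ 0) := by
  have hV : contrastMat t *ᵥ (fun j : Fin t => τ j.succ - τ 0) = fun i => τ i - τ 0 := by
    funext i
    refine Fin.cases ?_ (fun j => ?_) i
    · simp [contrastMat, Matrix.mulVec, dotProduct, (Fin.succ_ne_zero _).symm]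
    · simp [contrastMat, Matrix.mulVec, dotProduct]
  rw [← Matrix.mulVec_mulVec, hV]
  funext q
  simp [directMat, Matrix.mulVec, dotProduct]

/-- `A` is invariant under all permutations of the test treatments: `S' A S = A` for the
permutation matrices `S` of the treatments that leave the control treatment unchanged. -/
def TestInvariant (A : Matrix (Fin (t + 1)) (Fin (t + 1)) ℝ) : Prop :=
  ∀ σ : Equiv.Perm (Fin (t + 1)), σ 0 = 0 → A.submatrix σ σ = A

/-! ### The two constants of the bound -/

/-- `∑_{i=1}^t (m_{dii} - (1/p) ∑_u n_{diu} ñ_{diu})`. -/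
def carryTest (d : Design t n p) : ℝ :=
  ∑ i : Fin t, ((mIJ d i.succ i.succ : ℝ) -
    1 / (p : ℝ) * ∑ u, (nIU d i.succ u : ℝ) * (nTilde d i.succ u : ℝ))

/-- `m_{d00} - (1/p) ∑_u n_{d0u} ñ_{d0u}`. -/
def carryControl (d : Design t n p) : ℝ :=
  (mIJ d 0 0 : ℝ) - 1 / (p : ℝ) * ∑ u, (nIU d 0 u : ℝ) * (nTilde d 0 u : ℝ)

/-- `r̂_{d0} - ((p-1)/p) r_{d0} - m_{d00} + (1/p) ∑_u n_{d0u} ñ_{d0u}`. -/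
def carryMixed (d : Design t n p) : ℝ :=
  (repHat d : ℝ) - ((p : ℝ) - 1) / p * (rep d 0 : ℝ) - (mIJ d 0 0 : ℝ) +
    1 / (p : ℝ) * ∑ u, (nIU d 0 u : ℝ) * (nTilde d 0 u : ℝ)

/-- The constant `x_0`. -/
def x0 (d : Design t n p) : ℝ :=
  ((t : ℝ) * ((n : ℝ) * p - (rep d 0 : ℝ) -
        1 / (p : ℝ) * ∑ u, ∑ i : Fin t, (nIU d i.succ u : ℝ) ^ 2) -
      ((rep d 0 : ℝ) - 1 / (p : ℝ) * ∑ u, (nIU d 0 u : ℝ) ^ 2)) / ((t : ℝ) * ((t : ℝ) - 1)) -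
    ((t : ℝ) * p * (carryTest d + 1 / (t : ℝ) * carryMixed d) ^ 2) /
      (((t : ℝ) - 1) * ((n : ℝ) * ((p : ℝ) - 1) * ((p : ℝ) * t - t - 1) -
        ((p : ℝ) * t - t + p - 2) * (repTilde d 0 : ℝ) + ∑ u, (nTilde d 0 u : ℝ) ^ 2))

/-- The constant `y_0`. -/
def y0 (d : Design t n p) : ℝ :=
  1 / (t : ℝ) * ((rep d 0 : ℝ) - 1 / (p : ℝ) * ∑ u, (nIU d 0 u : ℝ) ^ 2) -
    ((p : ℝ) * ((n : ℝ) * ((p : ℝ) - 1) - (repTilde d 0 : ℝ)) * carryControl d ^ 2 +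
        (p : ℝ) * (repTilde d 0 : ℝ) * carryMixed d ^ 2) /
      ((t : ℝ) * ((n : ℝ) * p * ((p : ℝ) - 1) * (repTilde d 0 : ℝ) - (repTilde d 0 : ℝ) ^ 2 -
        (n : ℝ) * ((p : ℝ) - 1) * ∑ u, (nTilde d 0 u : ℝ) ^ 2))

end

end Crossover

/-! Every choice of nuisance coefficients bounds the quadratic form of `M_d` from above by a
residual sum of squares. Period effects are left out and the carryover coefficients are chosen with
the symmetry of the problem, so all sums reduce to counts within units (`withinForm`).

On the constant vector, one coefficient for the control and one common coefficient for the tests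
solve a 2 × 2 least-squares problem; its minimum is at most `t * y0`, because the mixed Gram entry
is nonpositive (`trace_infoContrast_mul_avgMat_le`). On the zero-sum vectors, carryover coefficients
`b • z` with a single slope `b`, summed over the centred unit vectors, give a quadratic in `b`; its
leading coefficient is largest when no test treatment recurs in the first `p - 1` periods, and
minimizing with that value gives `(t - 1) * x0` (`trace_infoContrast_mul_centMat_le`).

These two traces control `Tr M⁻¹` through `le_trace_inv`: with `S = C / x + J / y`, where `C` and
`J` are the centering and averaging projectors, `(1 - M S)' M⁻¹ (1 - M S)` is positive semidefinite,
so `Tr M⁻¹ ≥ 2 Tr S - Tr S M S`.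

Under (i)–(iii) the same kind of coefficients satisfy the full normal equations, period effects
included. Hence `M_d` has eigenvalue `x0` on the zero-sum vectors and `y0` on the constants, so `M_d
= x0 C + y0 J`, which settles both nonsingularity and the trace. -/

namespace Crossover

/-! ### Orthogonal projectors built from generalized inverses. -/

section Projector

variable {ι κ : Type*} [Fintype ι] [Fintype κ] [DecidableEq κ]

theorem ginv_spec (A : Matrix κ κ ℝ) : A * ginv A * A = A :=
  Classical.choose_spec (exists_ginv A)

theorem pr_mul_self (X : Matrix ι κ ℝ) : pr X * X = X := by
  -- The defect `pr X * X - X` is orthogonal to the columns of `X` and also lies in their span, so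
  -- it vanishes.
  have hX : Xᵀ * (pr X * X - X) = 0 := by
    have := ginv_spec (Xᵀ * X)
    simp only [pr, Matrix.mul_sub, ← Matrix.mul_assoc] at this ⊢
    rw [this, sub_self]
  have hE : pr X * X - X = X * (ginv (Xᵀ * X) * Xᵀ * X - 1) := by
    simp only [pr, Matrix.mul_sub, ← Matrix.mul_assoc, Matrix.mul_one]
  have h0 : (pr X * X - X)ᴴ * (pr X * X - X) = 0 := by
    rw [Matrix.conjTranspose_eq_transpose_of_trivial]
    nth_rewrite 1 [hE]
    rw [Matrix.transpose_mul, Matrix.mul_assoc, hX, Matrix.mul_zero]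
  exact sub_eq_zero.mp (Matrix.conjTranspose_mul_self_eq_zero.mp h0)

/-- The chosen generalized inverse need not be symmetric. But `(pr X)ᵀ` has its columns in the span
of `X`, so `pr X` fixes it, and `pr X * (pr X)ᵀ` is symmetric. -/
theorem pr_transpose (X : Matrix ι κ ℝ) : (pr X)ᵀ = pr X := by
  have h : pr X * (pr X)ᵀ = (pr X)ᵀ := by
    have : (pr X)ᵀ = X * ((ginv (Xᵀ * X))ᵀ * Xᵀ) := by
      simp [pr, Matrix.transpose_mul]
    rw [this, ← Matrix.mul_assoc, pr_mul_self]
  have h' := congrArg Matrix.transpose h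
  rw [Matrix.transpose_mul, Matrix.transpose_transpose, h] at h'
  exact h'

variable [DecidableEq ι]

theorem prPerp_mul_self (X : Matrix ι κ ℝ) : prPerp X * X = 0 := by
  rw [prPerp, Matrix.sub_mul, pr_mul_self, Matrix.one_mul, sub_self]

theorem prPerp_transpose (X : Matrix ι κ ℝ) : (prPerp X)ᵀ = prPerp X := by
  rw [prPerp, Matrix.transpose_sub, pr_transpose, Matrix.transpose_one]

theorem transpose_mul_prPerp (X : Matrix ι κ ℝ) : Xᵀ * prPerp X = 0 := by
  have := congrArg Matrix.transpose (prPerp_mul_self X)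
  rwa [Matrix.transpose_mul, prPerp_transpose, Matrix.transpose_zero] at this

theorem prPerp_mul_prPerp (X : Matrix ι κ ℝ) : prPerp X * prPerp X = prPerp X := by
  nth_rewrite 2 [prPerp]
  rw [pr, Matrix.mul_sub, Matrix.mul_one, ← Matrix.mul_assoc, ← Matrix.mul_assoc,
    prPerp_mul_self, Matrix.zero_mul, Matrix.zero_mul, sub_zero]

/-- The orthogonal projector is determined by its kernel. -/
theorem prPerp_eq_one_sub {X : Matrix ι κ ℝ} {Y : Matrix κ ι ℝ} (hsymm : (X * Y)ᵀ = X * Y)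
    (h : X * Y * X = X) : prPerp X = 1 - X * Y := by
  have h1 : prPerp X * (1 - X * Y) = prPerp X := by
    rw [Matrix.mul_sub, ← Matrix.mul_assoc, prPerp_mul_self, Matrix.zero_mul, Matrix.mul_one,
      sub_zero]
  have h2 : (1 - X * Y) * prPerp X = 1 - X * Y := by
    rw [prPerp, pr, Matrix.mul_sub, Matrix.mul_one, ← Matrix.mul_assoc, ← Matrix.mul_assoc,
      Matrix.sub_mul 1, h, Matrix.one_mul, sub_self, Matrix.zero_mul, Matrix.zero_mul, sub_zero]
  have h3 := congrArg Matrix.transpose h2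
  rw [Matrix.transpose_mul, prPerp_transpose, Matrix.transpose_sub, hsymm, Matrix.transpose_one,
    h1] at h3
  exact h3

theorem dotProduct_prPerp_mulVec (X : Matrix ι κ ℝ) (f g : ι → ℝ) :
    f ⬝ᵥ prPerp X *ᵥ g = (prPerp X *ᵥ f) ⬝ᵥ (prPerp X *ᵥ g) := by
  conv_rhs => rw [Matrix.dotProduct_mulVec, Matrix.vecMul_mulVec, prPerp_transpose,
    prPerp_mul_prPerp]
  exact Matrix.dotProduct_mulVec _ _ _

theorem dotProduct_prPerp_mulVec_nonneg (X : Matrix ι κ ℝ) (f : ι → ℝ) :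
    0 ≤ f ⬝ᵥ prPerp X *ᵥ f := by
  rw [dotProduct_prPerp_mulVec]
  exact Finset.sum_nonneg fun i _ => mul_self_nonneg _

theorem dotProduct_prPerp_mulVec_le (X : Matrix ι κ ℝ) (f : ι → ℝ) :
    f ⬝ᵥ prPerp X *ᵥ f ≤ f ⬝ᵥ f := by
  have h : 0 ≤ (f - prPerp X *ᵥ f) ⬝ᵥ (f - prPerp X *ᵥ f) :=
    Finset.sum_nonneg fun i _ => mul_self_nonneg _
  rw [sub_dotProduct, dotProduct_sub, dotProduct_sub, ← dotProduct_prPerp_mulVec,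
    dotProduct_comm (prPerp X *ᵥ f) f] at h
  linarith

theorem prPerp_mulVec_sub (Z : Matrix ι κ ℝ) (f : ι → ℝ) (w : κ → ℝ) :
    prPerp Z *ᵥ (f - Z *ᵥ w) = prPerp Z *ᵥ f := by
  rw [Matrix.mulVec_sub, Matrix.mulVec_mulVec, prPerp_mul_self, Matrix.zero_mulVec, sub_zero]

end Projector

/-! ### Information matrices as residual sums of squares. -/

section InformationMatrix

variable {ι κ ν : Type*} [Fintype ι] [DecidableEq ι] [Fintype ν] [DecidableEq ν]

theorem infoMatrix_transpose (X : Matrix ι κ ℝ) (Z : Matrix ι ν ℝ) :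
    (infoMatrix X Z)ᵀ = infoMatrix X Z := by
  simp [infoMatrix, Matrix.transpose_mul, prPerp_transpose, Matrix.mul_assoc]

variable [Fintype κ]

theorem dotProduct_infoMatrix_mulVec (X : Matrix ι κ ℝ) (Z : Matrix ι ν ℝ) (z : κ → ℝ) :
    z ⬝ᵥ infoMatrix X Z *ᵥ z = (X *ᵥ z) ⬝ᵥ prPerp Z *ᵥ (X *ᵥ z) := by
  rw [infoMatrix, Matrix.mul_assoc, ← Matrix.mulVec_mulVec, Matrix.dotProduct_mulVec,
    Matrix.vecMul_transpose, Matrix.mulVec_mulVec]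

theorem infoMatrix_posSemidef (X : Matrix ι κ ℝ) (Z : Matrix ι ν ℝ) :
    (infoMatrix X Z).PosSemidef := by
  refine Matrix.PosSemidef.of_dotProduct_mulVec_nonneg (infoMatrix_transpose X Z) fun z => ?_
  rw [star_trivial, dotProduct_infoMatrix_mulVec]
  exact dotProduct_prPerp_mulVec_nonneg _ _

/-- The least-squares fit is the best one; any trial `w` therefore yields an upper bound. -/
theorem dotProduct_infoMatrix_mulVec_le (X : Matrix ι κ ℝ) (Z : Matrix ι ν ℝ) (z : κ → ℝ)
    (w : ν → ℝ) :
    z ⬝ᵥ infoMatrix X Z *ᵥ z ≤ (X *ᵥ z - Z *ᵥ w) ⬝ᵥ (X *ᵥ z - Z *ᵥ w) := by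
  rw [dotProduct_infoMatrix_mulVec, dotProduct_prPerp_mulVec, ← prPerp_mulVec_sub Z _ w,
    ← dotProduct_prPerp_mulVec]
  exact dotProduct_prPerp_mulVec_le _ _

/-- A trial `w` that solves the normal equations leaves exactly the projected residual, so the
projector can be dropped. -/
theorem infoMatrix_mulVec_of_normal (X : Matrix ι κ ℝ) (Z : Matrix ι ν ℝ) (z : κ → ℝ)
    (w : ν → ℝ) (h : Zᵀ *ᵥ (X *ᵥ z - Z *ᵥ w) = 0) :
    infoMatrix X Z *ᵥ z = Xᵀ *ᵥ (X *ᵥ z - Z *ᵥ w) := by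
  have h1 : prPerp Z *ᵥ (X *ᵥ z - Z *ᵥ w) = X *ᵥ z - Z *ᵥ w := by
    nth_rewrite 1 [prPerp]
    rw [Matrix.sub_mulVec, pr, ← Matrix.mulVec_mulVec, h, Matrix.mulVec_zero, Matrix.one_mulVec,
      sub_zero]
  rw [infoMatrix, Matrix.mul_assoc, ← Matrix.mulVec_mulVec, ← Matrix.mulVec_mulVec,
    ← prPerp_mulVec_sub Z _ w, h1]

end InformationMatrix

/-! ### The within-unit form and trial residuals. -/

variable {t n p : ℕ}

/-- The form `f' pr^⊥(U) g` of sums of products within units. -/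
noncomputable def withinForm (n p : ℕ) : LinearMap.BilinForm ℝ (Fin n × Fin p → ℝ) :=
  Matrix.toBilin' (prPerp (unitMat n p))

theorem withinForm_apply (f g : Fin n × Fin p → ℝ) :
    withinForm n p f g = f ⬝ᵥ prPerp (unitMat n p) *ᵥ g :=
  Matrix.toBilin'_apply' _ _ _

theorem withinForm_comm (f g : Fin n × Fin p → ℝ) :
    withinForm n p f g = withinForm n p g f := by
  rw [withinForm_apply, withinForm_apply, dotProduct_prPerp_mulVec, dotProduct_comm,
    ← dotProduct_prPerp_mulVec]

theorem withinForm_eq (hp : p ≠ 0) (f g : Fin n × Fin p → ℝ) :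
    withinForm n p f g = ∑ u, ∑ k, f (u, k) * g (u, k) -
      1 / (p : ℝ) * ∑ u, (∑ k, f (u, k)) * ∑ k, g (u, k) := by
  have hp' : (p : ℝ) ≠ 0 := Nat.cast_ne_zero.mpr hp
  have hUU : (unitMat n p)ᵀ * unitMat n p = (p : ℝ) • 1 := by
    ext u v
    simp only [Matrix.mul_apply, Matrix.transpose_apply, unitMat, Matrix.of_apply,
      Fintype.sum_prod_type, Matrix.smul_apply, Matrix.one_apply]
    rcases eq_or_ne u v with rfl | h
    · simp
    · simp [h, h.symm]
  -- Since `U'U = p I`, the projector onto the unit space is `U U' / p`.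
  have hpr : prPerp (unitMat n p) = 1 - unitMat n p * ((1 / (p : ℝ)) • (unitMat n p)ᵀ) := by
    apply prPerp_eq_one_sub
    · simp [Matrix.transpose_mul]
    · rw [Matrix.mul_assoc, Matrix.smul_mul, hUU, smul_smul, one_div_mul_cancel hp', one_smul,
        Matrix.mul_one]
  have hU : ∀ h : Fin n × Fin p → ℝ, (unitMat n p)ᵀ *ᵥ h = fun u => ∑ k, h (u, k) := by
    intro h
    ext u
    simp only [Matrix.mulVec, dotProduct, unitMat, Matrix.transpose_apply, Matrix.of_apply,
      Fintype.sum_prod_type, ite_mul, one_mul, zero_mul]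
    rw [Finset.sum_comm]
    simp
  rw [withinForm_apply, hpr, Matrix.sub_mulVec, Matrix.one_mulVec, dotProduct_sub, Matrix.mul_smul,
    Matrix.smul_mulVec, dotProduct_smul, ← Matrix.mulVec_mulVec, Matrix.dotProduct_mulVec,
    ← Matrix.mulVec_transpose, hU, hU]
  simp [dotProduct, Fintype.sum_prod_type]

theorem periodMat_col_apply (k : Fin p) (q : Fin n × Fin p) :
    (periodMat n p).col k q = if q.2 = k then 1 else 0 := rfl

/-- The residual of `T_d V z` after fitting `F_d w` and the unit effects. -/
noncomputable def carryResidual (d : Design t n p) (z : Fin t → ℝ) (w : Fin (t + 1) → ℝ) :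
    Fin n × Fin p → ℝ :=
  directMat d *ᵥ (contrastMat t *ᵥ z) - carryMat d *ᵥ w

theorem exists_nuisance_fit (d : Design t n p) (z : Fin t → ℝ) (w : Fin (t + 1) → ℝ) :
    ∃ η, (directMat d * contrastMat t) *ᵥ z - nuisanceMat d *ᵥ η =
      prPerp (unitMat n p) *ᵥ carryResidual d z w := by
  -- Period coefficients zero, unit coefficients by least squares, carryover coefficients `w`.
  refine ⟨Sum.elim (Sum.elim 0 ((ginv ((unitMat n p)ᵀ * unitMat n p) * (unitMat n p)ᵀ) *ᵥ
    carryResidual d z w)) w, ?_⟩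
  rw [nuisanceMat, Matrix.fromCols_mulVec, Matrix.fromCols_mulVec]
  simp only [Sum.elim_comp_inl, Sum.elim_comp_inr, Matrix.mulVec_zero, zero_add]
  rw [prPerp, pr, Matrix.sub_mulVec, Matrix.one_mulVec, Matrix.mulVec_mulVec, ← Matrix.mul_assoc,
    carryResidual, Matrix.mulVec_mulVec]
  abel

theorem dotProduct_infoContrast_le (d : Design t n p) (z : Fin t → ℝ) (w : Fin (t + 1) → ℝ) :
    z ⬝ᵥ infoContrast d *ᵥ z ≤
      withinForm n p (carryResidual d z w) (carryResidual d z w) := by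
  obtain ⟨η, hη⟩ := exists_nuisance_fit d z w
  have := dotProduct_infoMatrix_mulVec_le (directMat d * contrastMat t) (nuisanceMat d) z η
  rwa [hη, ← dotProduct_prPerp_mulVec, ← withinForm_apply] at this

/-- The normal equations for the units hold automatically after projection, so only those for
periods and carryover remain as hypotheses. -/
theorem infoContrast_mulVec_apply (d : Design t n p) (z : Fin t → ℝ) (w : Fin (t + 1) → ℝ)
    (hP : ∀ k, withinForm n p ((periodMat n p).col k) (carryResidual d z w) = 0)
    (hF : ∀ i, withinForm n p ((carryMat d).col i) (carryResidual d z w) = 0) (j : Fin t) :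
    (infoContrast d *ᵥ z) j =
      withinForm n p ((directMat d).col j.succ) (carryResidual d z w) := by
  obtain ⟨η, hη⟩ := exists_nuisance_fit d z w
  rw [infoContrast, infoMatrix_mulVec_of_normal _ _ _ η, hη, withinForm_apply]
  · have : (directMat d * contrastMat t)ᵀ j = (directMat d).col j.succ := by
      ext q
      simp [Matrix.mul_apply, contrastMat, Matrix.col]
    rw [← this]
    rfl
  · rw [hη]
    ext ((k | u) | i)
    · exact (withinForm_apply _ _).symm.trans (hP k)
    · have := congrArg (fun A => (A *ᵥ carryResidual d z w) u) (transpose_mul_prPerp (unitMat n p))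
      simp only [← Matrix.mulVec_mulVec, Matrix.zero_mulVec] at this
      exact this
    · exact (withinForm_apply _ _).symm.trans (hF i)

/-! ### Entries and column sums of the incidence matrices. -/

theorem directMat_apply (d : Design t n p) (q : Fin n × Fin p) (i : Fin (t + 1)) :
    directMat d q i = if d q.2 q.1 = i then 1 else 0 := rfl

theorem carryMat_apply (d : Design t n p) (u : Fin n) (k : Fin p) (i : Fin (t + 1)) :
    carryMat d (u, k) i = ∑ k' : Fin p, if k'.val + 1 = k.val ∧ d k' u = i then 1 else 0 := by
  simp only [carryMat, Matrix.mul_apply, shiftMat, directMat, Matrix.of_apply, ite_and, ite_mul,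
    one_mul, zero_mul]

theorem carryMat_of_val_eq_zero (d : Design t n p) (u : Fin n) {k : Fin p} (hk : k.val = 0)
    (i : Fin (t + 1)) : carryMat d (u, k) i = 0 := by
  simp [carryMat_apply, hk]

theorem carryMat_of_succ (d : Design t n p) (u : Fin n) {k k' : Fin p}
    (hk : k'.val + 1 = k.val) (i : Fin (t + 1)) :
    carryMat d (u, k) i = directMat d (u, k') i := by
  rw [carryMat_apply, Finset.sum_eq_single k']
  · simp [hk, directMat_apply]
  · intro b _ hb
    rw [if_neg]
    rintro ⟨h, -⟩
    exact hb (Fin.ext (by omega))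
  · simp

theorem carryMat_zero_or_direct (d : Design t n p) (q : Fin n × Fin p) :
    (q.2.val = 0 ∧ ∀ i, carryMat d q i = 0) ∨
      0 < q.2.val ∧ ∃ k', k'.val + 1 = q.2.val ∧
        ∀ i, carryMat d q i = directMat d (q.1, k') i := by
  obtain ⟨u, k⟩ := q
  rcases Nat.eq_zero_or_pos k.val with hk | hk
  · exact Or.inl ⟨hk, carryMat_of_val_eq_zero d u hk⟩
  · have h : (⟨k.val - 1, by omega⟩ : Fin p).val + 1 = k.val := Nat.sub_add_cancel hk
    exact Or.inr ⟨hk, _, h, carryMat_of_succ d u h⟩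

theorem directMat_mul_self (d : Design t n p) (q : Fin n × Fin p) (i : Fin (t + 1)) :
    directMat d q i * directMat d q i = directMat d q i := by
  simp [directMat_apply]

theorem carryMat_mul_self (d : Design t n p) (q : Fin n × Fin p) (i : Fin (t + 1)) :
    carryMat d q i * carryMat d q i = carryMat d q i := by
  rcases carryMat_zero_or_direct d q with ⟨-, h⟩ | ⟨-, k', -, h⟩ <;>
    simp [h, directMat_mul_self]

theorem sum_directMat_col (d : Design t n p) : ∑ i, (directMat d).col i = 1 := by
  ext q
  simp [directMat_apply]

/-- The incidence vector of the periods other than the first. -/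
def lagVec (n p : ℕ) : Fin n × Fin p → ℝ := fun q => if 0 < q.2.val then 1 else 0

theorem sum_carryMat_col (d : Design t n p) : ∑ i, (carryMat d).col i = lagVec n p := by
  ext q
  simp only [Finset.sum_apply, Matrix.col_apply, lagVec]
  rcases carryMat_zero_or_direct d q with ⟨h0, h⟩ | ⟨h0, k', -, h⟩
  · simp [h, h0]
  · simp [h, h0, directMat_apply]

theorem sum_directMat_test (d : Design t n p) :
    ∑ j : Fin t, (directMat d).col j.succ = 1 - (directMat d).col 0 := by
  rw [← sum_directMat_col d, Fin.sum_univ_succ, add_sub_cancel_left]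

theorem sum_carryMat_test (d : Design t n p) :
    ∑ j : Fin t, (carryMat d).col j.succ = lagVec n p - (carryMat d).col 0 := by
  rw [← sum_carryMat_col d, Fin.sum_univ_succ, add_sub_cancel_left]

/-! ### Sums of incidences -/

theorem sum_period_directMat (d : Design t n p) (u : Fin n) (i : Fin (t + 1)) :
    ∑ k, directMat d (u, k) i = nIU d i u := by
  simp [directMat_apply, nIU]

theorem sum_unit_directMat (d : Design t n p) (k : Fin p) (i : Fin (t + 1)) :
    ∑ u, directMat d (u, k) i = lIK d i k := by
  simp [directMat_apply, lIK]

/-- Reindexes by the period that causes the carryover; the last period causes none, hence the guard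
`k'.val + 1 < p`. -/
theorem sum_carryMat_mul (d : Design t n p) (u : Fin n) (i : Fin (t + 1)) (φ : Fin p → ℝ) :
    ∑ k, φ k * carryMat d (u, k) i =
      ∑ k' : Fin p, if h : k'.val + 1 < p then
        φ ⟨k'.val + 1, h⟩ * directMat d (u, k') i else 0 := by
  simp only [carryMat_apply, Finset.mul_sum]
  rw [Finset.sum_comm]
  refine Finset.sum_congr rfl fun k' _ => ?_
  split_ifs with h
  · rw [Finset.sum_eq_single ⟨k'.val + 1, h⟩]
    · simp [directMat_apply]
    · intro b _ hb
      rw [if_neg, mul_zero]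
      rintro ⟨h', -⟩
      exact hb (Fin.ext h'.symm)
    · simp
  · refine Finset.sum_eq_zero fun k _ => ?_
    rw [if_neg, mul_zero]
    rintro ⟨h', -⟩
    exact h (h' ▸ k.isLt)

theorem sum_period_carryMat (d : Design t n p) (u : Fin n) (i : Fin (t + 1)) :
    ∑ k, carryMat d (u, k) i = nTilde d i u := by
  have := sum_carryMat_mul d u i 1
  simp only [Pi.one_apply, one_mul] at this
  rw [this, nTilde, Finset.natCast_card_filter]
  refine Finset.sum_congr rfl fun k _ => ?_
  by_cases h : k.val + 1 < p <;> simp [h, directMat_apply]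

theorem sum_nIU (d : Design t n p) (i : Fin (t + 1)) :
    ∑ u, (nIU d i u : ℝ) = rep d i := by
  simp only [nIU, rep, Finset.natCast_card_filter, Fintype.sum_prod_type]
  exact Finset.sum_comm

theorem sum_nTilde (d : Design t n p) (i : Fin (t + 1)) :
    ∑ u, (nTilde d i u : ℝ) = repTilde d i := by
  simp only [nTilde, repTilde, Finset.natCast_card_filter, Fintype.sum_prod_type]
  exact Finset.sum_comm

theorem sum_lagVec (hp : p ≠ 0) (u : Fin n) : ∑ k, lagVec n p (u, k) = (p : ℝ) - 1 := by
  obtain ⟨m, rfl⟩ := Nat.exists_eq_succ_of_ne_zero hp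
  rw [Fin.sum_univ_succ]
  simp [lagVec]

theorem sum_nIU_treatment (d : Design t n p) (u : Fin n) : ∑ i, (nIU d i u : ℝ) = p := by
  simp only [← sum_period_directMat]
  rw [Finset.sum_comm]
  simp [directMat_apply]

theorem sum_nTilde_treatment (hp : p ≠ 0) (d : Design t n p) (u : Fin n) :
    ∑ i, (nTilde d i u : ℝ) = (p : ℝ) - 1 := by
  simp only [← sum_period_carryMat]
  rw [Finset.sum_comm, ← sum_lagVec hp u, ← sum_carryMat_col d]
  simp [Finset.sum_apply]

theorem nTilde_le (hp : p ≠ 0) (d : Design t n p) (i : Fin (t + 1)) (u : Fin n) :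
    (nTilde d i u : ℝ) ≤ (p : ℝ) - 1 := by
  rw [← sum_nTilde_treatment hp d u]
  exact Finset.single_le_sum (f := fun i => (nTilde d i u : ℝ)) (fun _ _ => Nat.cast_nonneg _)
    (Finset.mem_univ i)

theorem sum_directMat_mul_carryMat (d : Design t n p) (i j : Fin (t + 1)) :
    ∑ u, ∑ k, directMat d (u, k) i * carryMat d (u, k) j = mIJ d i j := by
  simp only [mIJ, Finset.natCast_card_filter, Fintype.sum_prod_type, carryMat_apply,
    Finset.mul_sum, directMat_apply]
  rw [Finset.sum_comm]
  refine Finset.sum_congr rfl fun k _ => ?_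
  rw [Finset.sum_comm]
  refine Finset.sum_congr rfl fun k' _ => Finset.sum_congr rfl fun u _ => ?_
  by_cases h1 : d k u = i <;> by_cases h2 : k'.val + 1 = k.val <;> simp [h1, h2]

/-! ### The within-unit form on incidence vectors -/

theorem withinForm_one (hp : p ≠ 0) (f : Fin n × Fin p → ℝ) : withinForm n p f 1 = 0 := by
  have : (p : ℝ) ≠ 0 := Nat.cast_ne_zero.mpr hp
  rw [withinForm_eq hp]
  simp only [Pi.one_apply, mul_one, Finset.sum_const, Finset.card_univ, Fintype.card_fin,
    nsmul_eq_mul, ← Finset.sum_mul]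
  field_simp
  ring

theorem withinForm_direct_direct (hp : p ≠ 0) (d : Design t n p) (i : Fin (t + 1)) :
    withinForm n p ((directMat d).col i) ((directMat d).col i) =
      rep d i - 1 / (p : ℝ) * ∑ u, (nIU d i u : ℝ) ^ 2 := by
  simp only [withinForm_eq hp, Matrix.col_apply, directMat_mul_self, sum_period_directMat,
    sum_nIU, sq]

theorem withinForm_direct_carry (hp : p ≠ 0) (d : Design t n p) (i j : Fin (t + 1)) :
    withinForm n p ((directMat d).col i) ((carryMat d).col j) =
      mIJ d i j - 1 / (p : ℝ) * ∑ u, (nIU d i u : ℝ) * nTilde d j u := by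
  simp only [withinForm_eq hp, Matrix.col_apply, sum_directMat_mul_carryMat,
    sum_period_directMat, sum_period_carryMat]

theorem withinForm_carry_carry (hp : p ≠ 0) (d : Design t n p) (i : Fin (t + 1)) :
    withinForm n p ((carryMat d).col i) ((carryMat d).col i) =
      repTilde d i - 1 / (p : ℝ) * ∑ u, (nTilde d i u : ℝ) ^ 2 := by
  simp only [withinForm_eq hp, Matrix.col_apply, carryMat_mul_self, sum_period_carryMat,
    sum_nTilde, sq]

theorem withinForm_direct_lag (hp : p ≠ 0) (d : Design t n p) :
    withinForm n p ((directMat d).col 0) (lagVec n p) =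
      repHat d - ((p : ℝ) - 1) / p * rep d 0 := by
  have h : ∑ u, ∑ k, directMat d (u, k) 0 * lagVec n p (u, k) = repHat d := by
    simp only [repHat, Finset.natCast_card_filter, Fintype.sum_prod_type]
    rw [Finset.sum_comm]
    refine Finset.sum_congr rfl fun k _ => Finset.sum_congr rfl fun u _ => ?_
    by_cases h1 : d k u = 0 <;> by_cases h2 : 0 < k.val <;>
      simp [h1, h2, directMat_apply, lagVec]
  simp only [withinForm_eq hp, Matrix.col_apply, h, sum_period_directMat, sum_lagVec hp,
    ← Finset.sum_mul, sum_nIU]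
  ring

theorem carryMat_mul_lagVec (d : Design t n p) (q : Fin n × Fin p) (i : Fin (t + 1)) :
    carryMat d q i * lagVec n p q = carryMat d q i := by
  rcases carryMat_zero_or_direct d q with ⟨h0, h⟩ | ⟨h0, k', -, h⟩
  · simp [h]
  · simp [lagVec, h0]

theorem withinForm_carry_lag (hp : p ≠ 0) (d : Design t n p) (i : Fin (t + 1)) :
    withinForm n p ((carryMat d).col i) (lagVec n p) = repTilde d i / (p : ℝ) := by
  have : (p : ℝ) ≠ 0 := Nat.cast_ne_zero.mpr hp
  simp only [withinForm_eq hp, Matrix.col_apply, carryMat_mul_lagVec, sum_period_carryMat,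
    sum_lagVec hp, ← Finset.sum_mul, sum_nTilde]
  field_simp
  ring

theorem withinForm_lag_lag (hp : p ≠ 0) :
    withinForm n p (lagVec n p) (lagVec n p) = n * ((p : ℝ) - 1) / p := by
  have : (p : ℝ) ≠ 0 := Nat.cast_ne_zero.mpr hp
  have h : ∀ q, lagVec n p q * lagVec n p q = lagVec n p q := by
    intro q
    simp [lagVec]
  simp only [withinForm_eq hp, h, sum_lagVec hp, Finset.sum_const, Finset.card_univ,
    Fintype.card_fin, nsmul_eq_mul]
  field_simp
  ring

theorem withinForm_period (hp : p ≠ 0) (k : Fin p) (f : Fin n × Fin p → ℝ) :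
    withinForm n p ((periodMat n p).col k) f = ∑ u, f (u, k) - 1 / (p : ℝ) * ∑ u, ∑ k, f (u, k) := by
  simp only [withinForm_eq hp, periodMat_col_apply, ite_mul, one_mul, zero_mul,
    Finset.sum_ite_eq', Finset.mem_univ, if_true]

theorem lagVec_eq_sum_period (n p : ℕ) :
    lagVec n p = ∑ k : Fin p, (if 0 < k.val then (1 : ℝ) else 0) • (periodMat n p).col k := by
  ext q
  simp only [lagVec, Finset.sum_apply, Pi.smul_apply, periodMat_col_apply, smul_eq_mul, mul_ite,
    mul_one, mul_zero, Finset.sum_ite_eq, Finset.mem_univ, if_true]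

/-- The within-unit form of the sum of the test columns of `F_d`. -/
theorem withinForm_carryTests (hp : p ≠ 0) (d : Design t n p) :
    withinForm n p (lagVec n p - (carryMat d).col 0) (lagVec n p - (carryMat d).col 0) =
      (n * ((p : ℝ) - 1) - 2 * repTilde d 0) / p + repTilde d 0 -
        1 / (p : ℝ) * ∑ u, (nTilde d 0 u : ℝ) ^ 2 := by
  simp only [map_sub, LinearMap.sub_apply, withinForm_lag_lag hp, withinForm_carry_carry hp,
    withinForm_carry_lag hp, withinForm_comm (lagVec n p) ((carryMat d).col 0)]
  ring

theorem withinForm_directControl_carryTests (hp : p ≠ 0) (d : Design t n p) :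
    withinForm n p ((directMat d).col 0) (lagVec n p - (carryMat d).col 0) = carryMixed d := by
  rw [map_sub, withinForm_direct_lag hp, withinForm_direct_carry hp, carryMixed]
  ring

theorem withinForm_directControl_carryControl (hp : p ≠ 0) (d : Design t n p) :
    withinForm n p ((directMat d).col 0) ((carryMat d).col 0) = carryControl d := by
  rw [withinForm_direct_carry hp, carryControl]

theorem sum_withinForm_direct_carry (hp : p ≠ 0) (d : Design t n p) :
    ∑ j : Fin t, withinForm n p ((directMat d).col j.succ) ((carryMat d).col j.succ) =
      carryTest d := by
  simp only [withinForm_direct_carry hp, carryTest]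

theorem sum_withinForm_direct_direct (hp : p ≠ 0) (d : Design t n p) :
    ∑ j : Fin t, withinForm n p ((directMat d).col j.succ) ((directMat d).col j.succ) =
      n * (p : ℝ) - rep d 0 - 1 / (p : ℝ) * ∑ u, ∑ i : Fin t, (nIU d i.succ u : ℝ) ^ 2 := by
  have h : ∑ i, (rep d i : ℝ) = n * p := by
    simp only [← sum_nIU]
    rw [Finset.sum_comm]
    simp [sum_nIU_treatment]
  rw [Fin.sum_univ_succ] at h
  simp only [withinForm_direct_direct hp, Finset.sum_sub_distrib, ← Finset.mul_sum]
  rw [← h, Finset.sum_comm]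
  ring

theorem sum_repTilde_test (hp : p ≠ 0) (d : Design t n p) :
    ∑ j : Fin t, (repTilde d j.succ : ℝ) = n * ((p : ℝ) - 1) - repTilde d 0 := by
  have h : ∑ i, (repTilde d i : ℝ) = n * ((p : ℝ) - 1) := by
    simp only [← sum_nTilde]
    rw [Finset.sum_comm]
    simp only [sum_nTilde_treatment hp, Finset.sum_const, Finset.card_univ, Fintype.card_fin,
      nsmul_eq_mul]
  rw [← h, Fin.sum_univ_succ]
  ring

/-- A natural number is at most its square, with equality for 0 and 1; this is where condition (iii)
becomes the extremal case. -/
theorem repTilde_le_sum_sq (d : Design t n p) (i : Fin (t + 1)) :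
    (repTilde d i : ℝ) ≤ ∑ u, (nTilde d i u : ℝ) ^ 2 := by
  rw [← sum_nTilde]
  exact Finset.sum_le_sum fun u _ => mod_cast Nat.le_self_pow two_ne_zero _

theorem sum_sq_eq_repTilde (d : Design t n p) {i : Fin (t + 1)} (h : ∀ u, nTilde d i u ≤ 1) :
    ∑ u, (nTilde d i u : ℝ) ^ 2 = repTilde d i := by
  rw [← sum_nTilde]
  refine Finset.sum_congr rfl fun u _ => ?_
  rcases Nat.le_one_iff_eq_zero_or_eq_one.mp (h u) with h | h <;> simp [h]

theorem sum_withinForm_carry_carry_le (hp : p ≠ 0) (d : Design t n p) :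
    ∑ j : Fin t, withinForm n p ((carryMat d).col j.succ) ((carryMat d).col j.succ) ≤
      (1 - 1 / (p : ℝ)) * (n * ((p : ℝ) - 1) - repTilde d 0) := by
  rw [← sum_repTilde_test hp, Finset.mul_sum]
  refine Finset.sum_le_sum fun j _ => ?_
  rw [withinForm_carry_carry hp, sub_mul, one_mul]
  have := repTilde_le_sum_sq d j.succ
  gcongr

theorem sum_withinForm_carry_carry (hp : p ≠ 0) (d : Design t n p)
    (h : ∀ i : Fin (t + 1), i ≠ 0 → ∀ u, nTilde d i u ≤ 1) :
    ∑ j : Fin t, withinForm n p ((carryMat d).col j.succ) ((carryMat d).col j.succ) =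
      (1 - 1 / (p : ℝ)) * (n * ((p : ℝ) - 1) - repTilde d 0) := by
  rw [← sum_repTilde_test hp, Finset.mul_sum]
  refine Finset.sum_congr rfl fun j _ => ?_
  rw [withinForm_carry_carry hp, sum_sq_eq_repTilde d (h _ (Fin.succ_ne_zero j))]
  ring

/-! ### Averaging and centering matrices -/

/-- The projector onto the constant vectors. -/
noncomputable def avgMat (t : ℕ) : Matrix (Fin t) (Fin t) ℝ := Matrix.of fun _ _ => 1 / (t : ℝ)

/-- The projector onto the vectors with zero sum. -/
noncomputable def centMat (t : ℕ) : Matrix (Fin t) (Fin t) ℝ := 1 - avgMat t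

theorem avgMat_mul_self (ht : t ≠ 0) : avgMat t * avgMat t = avgMat t := by
  have : (t : ℝ) ≠ 0 := Nat.cast_ne_zero.mpr ht
  ext i j
  simp [avgMat, Matrix.mul_apply]
  field_simp

theorem centMat_mul_self (ht : t ≠ 0) : centMat t * centMat t = centMat t := by
  simp [centMat, Matrix.sub_mul, Matrix.mul_sub, avgMat_mul_self ht]

theorem avgMat_mul_centMat (ht : t ≠ 0) : avgMat t * centMat t = 0 := by
  simp [centMat, Matrix.mul_sub, avgMat_mul_self ht]

theorem centMat_mul_avgMat (ht : t ≠ 0) : centMat t * avgMat t = 0 := by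
  simp [centMat, Matrix.sub_mul, avgMat_mul_self ht]

theorem avgMat_transpose : (avgMat t)ᵀ = avgMat t := rfl

theorem centMat_transpose : (centMat t)ᵀ = centMat t := by
  rw [centMat, Matrix.transpose_sub, Matrix.transpose_one, avgMat_transpose]

theorem trace_avgMat (ht : t ≠ 0) : (avgMat t).trace = 1 := by
  have : (t : ℝ) ≠ 0 := Nat.cast_ne_zero.mpr ht
  simp [avgMat, Matrix.trace, this]

theorem trace_centMat (ht : t ≠ 0) : (centMat t).trace = (t : ℝ) - 1 := by
  simp [centMat, Matrix.trace_sub, trace_avgMat ht]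

theorem centMat_col (i : Fin t) : (centMat t).col i = Pi.single i 1 - fun _ => 1 / (t : ℝ) := by
  ext j
  simp [centMat, avgMat, Matrix.one_apply, Pi.single_apply]

theorem trace_mul_avgMat (M : Matrix (Fin t) (Fin t) ℝ) :
    (M * avgMat t).trace = 1 / (t : ℝ) * (1 ⬝ᵥ M *ᵥ 1) := by
  simp [avgMat, Matrix.trace, Matrix.mul_apply, dotProduct, Matrix.mulVec, ← Finset.sum_mul, mul_comm]

theorem trace_mul_centMat (ht : t ≠ 0) (M : Matrix (Fin t) (Fin t) ℝ) :
    (M * centMat t).trace = ∑ i, (centMat t).col i ⬝ᵥ M *ᵥ (centMat t).col i := by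
  have h : (M * centMat t).trace = ((centMat t)ᵀ * (M * centMat t)).trace := by
    rw [centMat_transpose, Matrix.trace_mul_comm (centMat t), Matrix.mul_assoc, centMat_mul_self ht]
  exact h

/-- If the mean eigenvalue of a positive definite `M` on the zero-sum vectors is at most `x` and
its Rayleigh quotient at the constant vector is at most `y`, then `Tr M⁻¹ ≥ (t - 1) / x + 1 / y`. -/
theorem le_trace_inv (ht : t ≠ 0) {M : Matrix (Fin t) (Fin t) ℝ} (hM : M.PosDef) {x y : ℝ}
    (hx : 0 < x) (hy : 0 < y) (hMx : (M * centMat t).trace ≤ ((t : ℝ) - 1) * x)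
    (hMy : (M * avgMat t).trace ≤ y) : ((t : ℝ) - 1) / x + 1 / y ≤ M⁻¹.trace := by
  set S := (1 / x) • centMat t + (1 / y) • avgMat t with hS
  have hST : Sᵀ = S := by
    simp [hS, centMat_transpose, avgMat_transpose]
  have hMT : Mᵀ = M := hM.isHermitian
  have hu : IsUnit M.det := (Matrix.isUnit_iff_isUnit_det M).mp hM.isUnit
  have hSS : S * S = (1 / x ^ 2) • centMat t + (1 / y ^ 2) • avgMat t := by
    simp only [hS, Matrix.add_mul, Matrix.mul_add, Matrix.smul_mul, Matrix.mul_smul,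
      centMat_mul_self ht, avgMat_mul_self ht, avgMat_mul_centMat ht, centMat_mul_avgMat ht,
      smul_zero, add_zero, zero_add, smul_smul]
    congr 2 <;> ring
  have htr : S.trace = ((t : ℝ) - 1) / x + 1 / y := by
    simp only [hS, Matrix.trace_add, Matrix.trace_smul, trace_centMat ht, trace_avgMat ht,
      smul_eq_mul]
    ring
  have hSMS : (S * M * S).trace ≤ ((t : ℝ) - 1) / x + 1 / y := by
    rw [Matrix.trace_mul_comm, ← Matrix.mul_assoc, Matrix.trace_mul_comm, hSS, Matrix.mul_add,
      Matrix.mul_smul, Matrix.mul_smul, Matrix.trace_add, Matrix.trace_smul, Matrix.trace_smul,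
      smul_eq_mul, smul_eq_mul]
    have h1 := mul_le_mul_of_nonneg_left hMx (by positivity : (0 : ℝ) ≤ 1 / x ^ 2)
    have h2 := mul_le_mul_of_nonneg_left hMy (by positivity : (0 : ℝ) ≤ 1 / y ^ 2)
    have e1 : 1 / x ^ 2 * (((t : ℝ) - 1) * x) = ((t : ℝ) - 1) / x := by field_simp
    have e2 : 1 / y ^ 2 * y = 1 / y := by field_simp
    linarith
  -- Completing the square: this matrix equals `M⁻¹ - 2 S + S M S`, where `S` would be `M⁻¹` if `M`
  -- had eigenvalues `x` and `y`.
  have hpsd := (hM.inv.posSemidef.conjTranspose_mul_mul_same (1 - M * S)).trace_nonneg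
  have hexp : (1 - M * S)ᴴ * M⁻¹ * (1 - M * S) = M⁻¹ - S - S + S * M * S := by
    rw [Matrix.conjTranspose_eq_transpose_of_trivial, Matrix.transpose_sub, Matrix.transpose_mul,
      hST, hMT, Matrix.transpose_one, Matrix.sub_mul, Matrix.mul_assoc S,
      Matrix.mul_nonsing_inv M hu, Matrix.mul_sub, Matrix.sub_mul]
    simp only [Matrix.one_mul, Matrix.mul_one, Matrix.sub_mul, ← Matrix.mul_assoc]
    rw [Matrix.nonsing_inv_mul M hu, Matrix.one_mul]
    abel
  rw [hexp, Matrix.trace_add, Matrix.trace_sub, Matrix.trace_sub, htr] at hpsd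
  linarith

/-- A matrix with eigenvalue `x` on the zero-sum vectors and `y` on the constant vectors. -/
theorem eq_smul_centMat_add (ht : t ≠ 0) {M : Matrix (Fin t) (Fin t) ℝ} {x y : ℝ}
    (hx : ∀ z : Fin t → ℝ, ∑ i, z i = 0 → M *ᵥ z = x • z) (hy : M *ᵥ 1 = y • 1) :
    M = x • centMat t + y • avgMat t := by
  have ht' : (t : ℝ) ≠ 0 := Nat.cast_ne_zero.mpr ht
  refine Matrix.ext_of_mulVec_single fun i => ?_
  have h1 : (Pi.single i 1 : Fin t → ℝ) = (centMat t).col i + (1 / (t : ℝ)) • 1 := by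
    rw [centMat_col]
    ext j
    simp
  have h2 : ∑ j, (centMat t).col i j = 0 := by
    rw [centMat_col]
    simp [ht', Finset.sum_sub_distrib]
  conv_lhs => rw [h1, Matrix.mulVec_add, Matrix.mulVec_smul, hx _ h2, hy]
  ext j
  simp [Matrix.add_apply, avgMat]
  ring

theorem smul_centMat_add_mul (ht : t ≠ 0) {x y : ℝ} (hx : x ≠ 0) (hy : y ≠ 0) :
    (x • centMat t + y • avgMat t) * (x⁻¹ • centMat t + y⁻¹ • avgMat t) = 1 := by
  simp only [Matrix.add_mul, Matrix.mul_add, Matrix.smul_mul, Matrix.mul_smul,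
    centMat_mul_self ht, avgMat_mul_self ht, avgMat_mul_centMat ht, centMat_mul_avgMat ht,
    smul_zero, add_zero, zero_add, smul_smul, inv_mul_cancel₀ hx, inv_mul_cancel₀ hy, one_smul]
  exact sub_add_cancel (1 : Matrix (Fin t) (Fin t) ℝ) _

theorem trace_inv_smul_centMat_add (ht : t ≠ 0) {x y : ℝ} (hx : x ≠ 0) (hy : y ≠ 0) :
    (x • centMat t + y • avgMat t)⁻¹.trace = ((t : ℝ) - 1) / x + 1 / y := by
  rw [Matrix.inv_eq_right_inv (smul_centMat_add_mul ht hx hy)]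
  simp only [Matrix.trace_add, Matrix.trace_smul, trace_centMat ht, trace_avgMat ht, smul_eq_mul]
  ring

/-- The variance identity, for a bilinear form that need not be symmetric. -/
theorem sum_form_sub_mean {E : Type*} [AddCommGroup E] [Module ℝ E]
    (β : LinearMap.BilinForm ℝ E) (ht : t ≠ 0) (s : Fin t → E) :
    ∑ i, β (s i - (1 / (t : ℝ)) • ∑ j, s j) (s i - (1 / (t : ℝ)) • ∑ j, s j) =
      ∑ i, β (s i) (s i) - 1 / (t : ℝ) * β (∑ j, s j) (∑ j, s j) := by
  have ht' : (t : ℝ) ≠ 0 := Nat.cast_ne_zero.mpr ht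
  set m := ∑ j, s j with hm
  have h1 : ∑ i, β (s i) m = β m m := by
    rw [← LinearMap.sum_apply, ← map_sum]
  have h2 : ∑ i, β m (s i) = β m m := by
    rw [← map_sum]
  simp only [map_sub, map_smul, LinearMap.sub_apply, LinearMap.smul_apply, smul_eq_mul,
    Finset.sum_sub_distrib, ← Finset.mul_sum, h1, h2, Finset.sum_const, Finset.card_univ,
    Fintype.card_fin, nsmul_eq_mul]
  field_simp
  ring

/-! ### Invariance under permutations of the test treatments -/

theorem TestInvariant.apply {A : Matrix (Fin (t + 1)) (Fin (t + 1)) ℝ} (hA : TestInvariant A)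
    {σ : Equiv.Perm (Fin (t + 1))} (hσ : σ 0 = 0) (i j : Fin (t + 1)) :
    A (σ i) (σ j) = A i j :=
  congrFun (congrFun (hA σ hσ) i) j

theorem TestInvariant.diag {A : Matrix (Fin (t + 1)) (Fin (t + 1)) ℝ} (hA : TestInvariant A)
    (i j : Fin t) : A i.succ i.succ = A j.succ j.succ := by
  have := hA.apply (σ := Equiv.swap i.succ j.succ)
    (Equiv.swap_apply_of_ne_of_ne (Fin.succ_ne_zero _).symm (Fin.succ_ne_zero _).symm) j.succ j.succ
  rwa [Equiv.swap_apply_right] at this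

theorem TestInvariant.zero_left {A : Matrix (Fin (t + 1)) (Fin (t + 1)) ℝ}
    (hA : TestInvariant A) (i j : Fin t) : A 0 i.succ = A 0 j.succ := by
  have h0 : Equiv.swap i.succ j.succ 0 = 0 :=
    Equiv.swap_apply_of_ne_of_ne (Fin.succ_ne_zero _).symm (Fin.succ_ne_zero _).symm
  have := hA.apply h0 0 j.succ
  rwa [Equiv.swap_apply_right, h0] at this

theorem TestInvariant.zero_right {A : Matrix (Fin (t + 1)) (Fin (t + 1)) ℝ}
    (hA : TestInvariant A) (i j : Fin t) : A i.succ 0 = A j.succ 0 := by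
  have h0 : Equiv.swap i.succ j.succ 0 = 0 :=
    Equiv.swap_apply_of_ne_of_ne (Fin.succ_ne_zero _).symm (Fin.succ_ne_zero _).symm
  have := hA.apply h0 j.succ 0
  rwa [Equiv.swap_apply_right, h0] at this

/-- The permutations of the test treatments act transitively on ordered pairs of distinct ones.
Transpositions suffice: change one index at a time, except that the reversed pair needs a direct
swap. -/
theorem TestInvariant.offDiag {A : Matrix (Fin (t + 1)) (Fin (t + 1)) ℝ} (hA : TestInvariant A)
    {i j i' j' : Fin t} (h : i ≠ j) (h' : i' ≠ j') :
    A i.succ j.succ = A i'.succ j'.succ := by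
  have h0 : ∀ i j : Fin t, Equiv.swap i.succ j.succ 0 = 0 := fun i j =>
    Equiv.swap_apply_of_ne_of_ne (Fin.succ_ne_zero _).symm (Fin.succ_ne_zero _).symm
  have left : ∀ i i' j : Fin t, i ≠ j → i' ≠ j → A i.succ j.succ = A i'.succ j.succ := by
    intro i i' j h h'
    have := hA.apply (h0 i i') i'.succ j.succ
    rwa [Equiv.swap_apply_right, Equiv.swap_apply_of_ne_of_ne
      ((Fin.succ_injective t).ne h.symm) ((Fin.succ_injective t).ne h'.symm)] at this
  have right : ∀ i j j' : Fin t, i ≠ j → i ≠ j' → A i.succ j.succ = A i.succ j'.succ := by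
    intro i j j' h h'
    have := hA.apply (h0 j j') i.succ j'.succ
    rwa [Equiv.swap_apply_right, Equiv.swap_apply_of_ne_of_ne
      ((Fin.succ_injective t).ne h) ((Fin.succ_injective t).ne h')] at this
  have swap : ∀ i j : Fin t, A i.succ j.succ = A j.succ i.succ := by
    intro i j
    have := hA.apply (h0 i j) j.succ i.succ
    rwa [Equiv.swap_apply_right, Equiv.swap_apply_left] at this
  by_cases h1 : i' = j
  · subst h1
    by_cases h2 : j' = i
    · subst h2
      exact swap _ _
    · rw [right i i' j' h (Ne.symm h2), left i i' j' (Ne.symm h2) h']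
  · rw [left i i' j h h1, right i' j j' h1 h']

/-- An invariant matrix acts as a scalar on the zero-sum vectors of test treatments. -/
theorem TestInvariant.sum_mul (ht : 2 ≤ t) {A : Matrix (Fin (t + 1)) (Fin (t + 1)) ℝ}
    (hA : TestInvariant A) {z : Fin t → ℝ} (hz : ∑ i, z i = 0) (i : Fin t) :
    ((t : ℝ) - 1) * ∑ j : Fin t, z j * A i.succ j.succ =
      (∑ j : Fin t, A j.succ j.succ - 1 / (t : ℝ) * ∑ j : Fin t, ∑ k : Fin t, A j.succ k.succ) *
        z i := by
  have ht' : (t : ℝ) ≠ 0 := Nat.cast_ne_zero.mpr (by omega)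
  have h01 : (⟨0, by omega⟩ : Fin t) ≠ ⟨1, by omega⟩ := by simp
  set α := A i.succ i.succ with hα
  set β := A (Fin.succ ⟨0, by omega⟩ : Fin (t + 1)) (Fin.succ ⟨1, by omega⟩) with hβ
  have hA' : ∀ j k : Fin t, A j.succ k.succ = (if j = k then α - β else 0) + β := by
    intro j k
    split_ifs with h
    · rw [h, hA.diag k i]
      ring
    · rw [hA.offDiag h h01, zero_add]
  simp only [hA', mul_add, Finset.sum_add_distrib, ← Finset.sum_mul, hz, mul_ite, mul_zero,
    Finset.sum_ite_eq, Finset.mem_univ, if_true, Finset.sum_const, Finset.card_univ,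
    Fintype.card_fin, nsmul_eq_mul]
  field_simp
  ring

/-! ### Trial residuals, Gram entries and the constants in terms of them. -/

theorem carryResidual_eq (d : Design t n p) (z : Fin t → ℝ) (w : Fin (t + 1) → ℝ) :
    carryResidual d z w = ∑ j, z j • (directMat d).col j.succ -
      (w 0 • (carryMat d).col 0 + ∑ j : Fin t, w j.succ • (carryMat d).col j.succ) := by
  have hV : contrastMat t *ᵥ z = (Fin.cons 0 z : Fin (t + 1) → ℝ) := by
    funext i
    refine Fin.cases ?_ (fun j => ?_) i
    · simp [contrastMat, Matrix.mulVec, dotProduct, (Fin.succ_ne_zero _).symm]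
    · simp [contrastMat, Matrix.mulVec, dotProduct]
  rw [carryResidual, hV]
  ext q
  simp [Matrix.mulVec, dotProduct, Fin.sum_univ_succ, Finset.sum_apply, mul_comm]

/-- The sum of the columns of `F_d` that belong to the test treatments. -/
noncomputable def carryTestVec (d : Design t n p) : Fin n × Fin p → ℝ :=
  lagVec n p - (carryMat d).col 0

theorem carryResidual_const (d : Design t n p) (a b : ℝ) :
    carryResidual d 1 (Fin.cons a fun _ => b) =
      1 - (directMat d).col 0 - (a • (carryMat d).col 0 + b • carryTestVec d) := by
  simp only [carryResidual_eq, Pi.one_apply, one_smul, sum_directMat_test, Fin.cons_zero,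
    Fin.cons_succ, ← Finset.smul_sum, sum_carryMat_test, carryTestVec]

theorem carryResidual_smul (d : Design t n p) (z : Fin t → ℝ) (b : ℝ) :
    carryResidual d z (Fin.cons 0 (b • z)) =
      ∑ j, z j • ((directMat d).col j.succ - b • (carryMat d).col j.succ) := by
  simp only [carryResidual_eq, Fin.cons_zero, Fin.cons_succ, zero_smul, zero_add, smul_sub,
    Finset.sum_sub_distrib, Pi.smul_apply, smul_eq_mul, smul_smul, mul_comm b]

/-- `F_0' pr^⊥(U) F_0` for the control column `F_0` of `F_d`. -/
noncomputable def gramControl (d : Design t n p) : ℝ :=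
  withinForm n p ((carryMat d).col 0) ((carryMat d).col 0)

/-- The mixed entry `F_0' pr^⊥(U) (F_1 + ⋯ + F_t)`. -/
noncomputable def gramMixed (d : Design t n p) : ℝ :=
  withinForm n p ((carryMat d).col 0) (carryTestVec d)

/-- The entry for `F_1 + ⋯ + F_t`. -/
noncomputable def gramTest (d : Design t n p) : ℝ :=
  withinForm n p (carryTestVec d) (carryTestVec d)

theorem gramControl_eq (hp : p ≠ 0) (d : Design t n p) :
    gramControl d = repTilde d 0 - 1 / (p : ℝ) * ∑ u, (nTilde d 0 u : ℝ) ^ 2 :=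
  withinForm_carry_carry hp d 0

theorem gramMixed_eq (hp : p ≠ 0) (d : Design t n p) :
    gramMixed d = repTilde d 0 / (p : ℝ) - gramControl d := by
  rw [gramMixed, carryTestVec, map_sub, withinForm_carry_lag hp, gramControl]

theorem gramTest_eq (hp : p ≠ 0) (d : Design t n p) :
    gramTest d = (n * ((p : ℝ) - 1) - repTilde d 0) / p - gramMixed d := by
  rw [gramTest, carryTestVec, withinForm_carryTests hp, gramMixed_eq hp, gramControl_eq hp]
  ring

theorem sum_sq_nTilde_le (hp : p ≠ 0) (d : Design t n p) :
    ∑ u, (nTilde d 0 u : ℝ) ^ 2 ≤ ((p : ℝ) - 1) * repTilde d 0 := by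
  rw [← sum_nTilde, Finset.mul_sum]
  refine Finset.sum_le_sum fun u _ => ?_
  rw [sq]
  exact mul_le_mul_of_nonneg_right (nTilde_le hp d 0 u) (Nat.cast_nonneg _)

/-- The control and test columns of `F_d` have disjoint supports, so only the subtracted product of
unit totals survives. -/
theorem gramMixed_nonpos (hp : p ≠ 0) (d : Design t n p) : gramMixed d ≤ 0 := by
  have hp' : (0 : ℝ) < p := Nat.cast_pos.mpr (Nat.pos_of_ne_zero hp)
  have h := sum_sq_nTilde_le hp d
  have e : gramMixed d = (∑ u, (nTilde d 0 u : ℝ) ^ 2 - ((p : ℝ) - 1) * repTilde d 0) / p := by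
    rw [gramMixed_eq hp, gramControl_eq hp]
    field_simp
    ring
  rw [e]
  exact div_nonpos_of_nonpos_of_nonneg (by linarith) hp'.le

theorem gram_det_eq (hp : p ≠ 0) (d : Design t n p) :
    gramControl d * gramTest d - gramMixed d ^ 2 =
      ((n : ℝ) * p * ((p : ℝ) - 1) * (repTilde d 0 : ℝ) - (repTilde d 0 : ℝ) ^ 2 -
        (n : ℝ) * ((p : ℝ) - 1) * ∑ u, (nTilde d 0 u : ℝ) ^ 2) / (p : ℝ) ^ 2 := by
  have hp' : (p : ℝ) ≠ 0 := Nat.cast_ne_zero.mpr hp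
  rw [gramTest_eq hp, gramMixed_eq hp, gramControl_eq hp]
  field_simp
  ring

/-- Bounding `∑ ñ²` by `(p - 1) r̃` leaves at least `r̃ (n (p - 1) - r̃)` in the numerator, which is
positive because both control and tests occur in the first `p - 1` periods. -/
theorem gram_det_pos (hp : 3 ≤ p) (d : Design t n p) (hpos : 0 < repTilde d 0)
    (hlt : repTilde d 0 < n * (p - 1)) :
    0 < gramControl d * gramTest d - gramMixed d ^ 2 := by
  have hp0 : p ≠ 0 := by omega
  have hp' : (0 : ℝ) < p := Nat.cast_pos.mpr (by omega)
  have h1 : (0 : ℝ) < repTilde d 0 := Nat.cast_pos.mpr hpos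
  have h2 : (repTilde d 0 : ℝ) < n * ((p : ℝ) - 1) := by
    have := Nat.cast_lt (α := ℝ).mpr hlt
    rwa [Nat.cast_mul, Nat.cast_sub (by omega), Nat.cast_one] at this
  rw [gram_det_eq hp0]
  refine div_pos ?_ (by positivity)
  have h3 := mul_le_mul_of_nonneg_left (sum_sq_nTilde_le hp0 d) (h1.trans h2).le
  have h4 := mul_pos h1 (sub_pos.mpr h2)
  linarith

theorem y0_eq (hp : p ≠ 0) (ht : t ≠ 0) (d : Design t n p) :
    (t : ℝ) * y0 d = withinForm n p ((directMat d).col 0) ((directMat d).col 0) -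
      ((gramTest d + gramMixed d) * carryControl d ^ 2 +
        (gramControl d + gramMixed d) * carryMixed d ^ 2) /
          (gramControl d * gramTest d - gramMixed d ^ 2) := by
  have hp' : (p : ℝ) ≠ 0 := Nat.cast_ne_zero.mpr hp
  have ht' : (t : ℝ) ≠ 0 := Nat.cast_ne_zero.mpr ht
  have e1 : gramTest d + gramMixed d = (n * ((p : ℝ) - 1) - repTilde d 0) / p := by
    rw [gramTest_eq hp]
    ring
  have e2 : gramControl d + gramMixed d = repTilde d 0 / (p : ℝ) := by
    rw [gramMixed_eq hp]
    ring
  rw [gram_det_eq hp, e1, e2, withinForm_direct_direct hp, y0]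
  generalize (n : ℝ) * p * ((p : ℝ) - 1) * (repTilde d 0 : ℝ) - (repTilde d 0 : ℝ) ^ 2 -
        (n : ℝ) * ((p : ℝ) - 1) * ∑ u, (nTilde d 0 u : ℝ) ^ 2 = D
  -- Nothing is assumed about the denominator; if it is zero, both quotients are zero by convention.
  rcases eq_or_ne D 0 with rfl | hD
  · simp [ht']
  · field_simp

/-- The upper bound for the coefficient of the squared carryover slope: its value when no test
treatment is repeated in the first `p - 1` periods of a unit. -/
noncomputable def slopeGram (d : Design t n p) : ℝ :=
  (1 - 1 / (p : ℝ)) * (n * ((p : ℝ) - 1) - repTilde d 0) - 1 / (t : ℝ) * gramTest d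

theorem slopeGram_eq (hp : p ≠ 0) (ht : t ≠ 0) (d : Design t n p) :
    slopeGram d = ((n : ℝ) * ((p : ℝ) - 1) * ((p : ℝ) * t - t - 1) -
        ((p : ℝ) * t - t + p - 2) * (repTilde d 0 : ℝ) + ∑ u, (nTilde d 0 u : ℝ) ^ 2) /
          (t * p) := by
  have hp' : (p : ℝ) ≠ 0 := Nat.cast_ne_zero.mpr hp
  have ht' : (t : ℝ) ≠ 0 := Nat.cast_ne_zero.mpr ht
  rw [slopeGram, gramTest_eq hp, gramMixed_eq hp, gramControl_eq hp]
  field_simp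
  ring

theorem slopeGram_pos (hp : 3 ≤ p) (hpt : p ≤ t + 1) (d : Design t n p)
    (hlt : repTilde d 0 < n * (p - 1)) : 0 < slopeGram d := by
  have hp0 : p ≠ 0 := by omega
  have hp3 : (3 : ℝ) ≤ p := by exact_mod_cast hp
  have ht2 : (2 : ℝ) ≤ t := by exact_mod_cast (by omega : 2 ≤ t)
  have h2 : (repTilde d 0 : ℝ) < n * ((p : ℝ) - 1) := by
    have := Nat.cast_lt (α := ℝ).mpr hlt
    rwa [Nat.cast_mul, Nat.cast_sub (by omega), Nat.cast_one] at this
  rw [slopeGram_eq hp0 (by omega)]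
  refine div_pos ?_ (by positivity)
  have hc : 0 < (p : ℝ) * t - t - 1 - (p - 1) := by nlinarith
  -- With `v = p - 1 - ñ`, the contribution of a unit is exactly `c v + v²`, where `c` is the
  -- positive constant of `hc`.
  have hterm : ∀ u, ((p : ℝ) * t - t - 1 - (p - 1)) * ((p : ℝ) - 1 - nTilde d 0 u) ≤
      ((p : ℝ) - 1) * ((p : ℝ) * t - t - 1) - ((p : ℝ) * t - t + p - 2) * nTilde d 0 u +
        (nTilde d 0 u : ℝ) ^ 2 := fun u => by
    nlinarith [sq_nonneg ((p : ℝ) - 1 - nTilde d 0 u)]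
  have hsum := Finset.sum_le_sum fun u (_ : u ∈ Finset.univ) => hterm u
  simp only [← Finset.mul_sum, Finset.sum_add_distrib, Finset.sum_sub_distrib, sum_nTilde,
    Finset.sum_const, Finset.card_univ, Fintype.card_fin, nsmul_eq_mul] at hsum
  have := mul_pos hc (sub_pos.mpr h2)
  linarith

theorem x0_eq (hp : p ≠ 0) (ht : 2 ≤ t) (d : Design t n p) :
    ((t : ℝ) - 1) * x0 d =
      ∑ j : Fin t, withinForm n p ((directMat d).col j.succ) ((directMat d).col j.succ) -
        1 / (t : ℝ) * withinForm n p ((directMat d).col 0) ((directMat d).col 0) -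
        (carryTest d + 1 / (t : ℝ) * carryMixed d) ^ 2 / slopeGram d := by
  have hp' : (p : ℝ) ≠ 0 := Nat.cast_ne_zero.mpr hp
  have ht' : (t : ℝ) ≠ 0 := Nat.cast_ne_zero.mpr (by omega)
  have ht1 : (t : ℝ) - 1 ≠ 0 := by
    have : (2 : ℝ) ≤ t := by exact_mod_cast ht
    linarith
  rw [slopeGram_eq hp (by omega), sum_withinForm_direct_direct hp, withinForm_direct_direct hp,
    x0]
  generalize (n : ℝ) * ((p : ℝ) - 1) * ((p : ℝ) * t - t - 1) -
        ((p : ℝ) * t - t + p - 2) * (repTilde d 0 : ℝ) + ∑ u, (nTilde d 0 u : ℝ) ^ 2 = D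
  generalize carryTest d + 1 / (t : ℝ) * carryMixed d = X
  rcases eq_or_ne D 0 with rfl | hD
  · simp
    field_simp
  · field_simp

theorem withinForm_one_left (hp : p ≠ 0) (f : Fin n × Fin p → ℝ) : withinForm n p 1 f = 0 := by
  rw [withinForm_comm, withinForm_one hp]

theorem withinForm_directControl_carryTestVec (hp : p ≠ 0) (d : Design t n p) :
    withinForm n p ((directMat d).col 0) (carryTestVec d) = carryMixed d :=
  withinForm_directControl_carryTests hp d

/-! ### The two trace bounds and the inequality. -/

theorem trace_infoContrast_mul_avgMat_le (hp : 3 ≤ p) (ht : t ≠ 0) (d : Design t n p)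
    (hpos : 0 < repTilde d 0) (hlt : repTilde d 0 < n * (p - 1)) :
    (infoContrast d * avgMat t).trace ≤ y0 d := by
  have hp0 : p ≠ 0 := by omega
  have ht' : (0 : ℝ) < t := Nat.cast_pos.mpr (Nat.pos_of_ne_zero ht)
  have hdet := gram_det_pos hp d hpos hlt
  have hmix := gramMixed_nonpos hp0 d
  rw [trace_mul_avgMat, one_div, inv_mul_le_iff₀ ht', y0_eq hp0 ht]
  set D := gramControl d * gramTest d - gramMixed d ^ 2 with hD
  -- Cramer's rule for the 2 × 2 normal equations `ea` and `eb`; the signs come from `T_d V 1 = 1 -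
  -- T_0`.
  refine (dotProduct_infoContrast_le d 1 (Fin.cons
    (-((gramTest d * carryControl d - gramMixed d * carryMixed d) / D)) fun _ =>
    (-((gramControl d * carryMixed d - gramMixed d * carryControl d) / D)))).trans ?_
  rw [carryResidual_const]
  set a := -((gramTest d * carryControl d - gramMixed d * carryMixed d) / D) with ha
  set b := -((gramControl d * carryMixed d - gramMixed d * carryControl d) / D) with hb
  have hG := withinForm_directControl_carryControl hp0 d
  have hB := withinForm_directControl_carryTestVec hp0 d
  have hG' := (withinForm_comm ((carryMat d).col 0) ((directMat d).col 0)).trans hG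
  have hB' := (withinForm_comm (carryTestVec d) ((directMat d).col 0)).trans hB
  have hcc : withinForm n p ((carryMat d).col 0) ((carryMat d).col 0) = gramControl d := rfl
  have hcm : withinForm n p ((carryMat d).col 0) (carryTestVec d) = gramMixed d := rfl
  have hct : withinForm n p (carryTestVec d) (carryTestVec d) = gramTest d := rfl
  have hm' := (withinForm_comm (carryTestVec d) ((carryMat d).col 0)).trans hcm
  simp only [map_sub, map_add, map_smul, LinearMap.sub_apply, LinearMap.add_apply,
    LinearMap.smul_apply, smul_eq_mul, withinForm_one hp0, withinForm_one_left hp0, hG, hB, hG',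
    hB', hm', hcc, hcm, hct]
  have ea : gramControl d * a + gramMixed d * b = -carryControl d := by
    rw [ha, hb]
    field_simp
    rw [hD]
    ring
  have eb : gramMixed d * a + gramTest d * b = -carryMixed d := by
    rw [ha, hb]
    field_simp
    rw [hD]
    ring
  -- The attained minimum differs from `t * y0` by a multiple of `(G + B)²` with the sign of the
  -- mixed Gram entry.
  have hval : a * carryControl d + b * carryMixed d +
      ((gramTest d + gramMixed d) * carryControl d ^ 2 +
        (gramControl d + gramMixed d) * carryMixed d ^ 2) / D =
      gramMixed d * (carryControl d + carryMixed d) ^ 2 / D := by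
    rw [ha, hb]
    field_simp
    ring
  have hle : gramMixed d * (carryControl d + carryMixed d) ^ 2 / D ≤ 0 :=
    div_nonpos_of_nonpos_of_nonneg (mul_nonpos_of_nonpos_of_nonneg hmix (sq_nonneg _)) hdet.le
  linear_combination hle + hval + a * ea + b * eb

/-- Summing the trial bounds over the centred unit vectors turns them into a variance of the vectors
`T_j - b F_j`, a quadratic in `b` whose leading coefficient is at most `slopeGram d`. -/
theorem trace_infoContrast_mul_centMat_le (hp : 3 ≤ p) (hpt : p ≤ t + 1) (d : Design t n p)
    (hlt : repTilde d 0 < n * (p - 1)) :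
    (infoContrast d * centMat t).trace ≤ ((t : ℝ) - 1) * x0 d := by
  have hp0 : p ≠ 0 := by omega
  have ht : t ≠ 0 := by omega
  have hgram := slopeGram_pos hp hpt d hlt
  rw [trace_mul_centMat ht, x0_eq hp0 (by omega)]
  set X := carryTest d + 1 / (t : ℝ) * carryMixed d with hX
  -- Minimizer of `-2 b X + b² * slopeGram d`.
  set b := X / slopeGram d with hb
  set s : Fin t → Fin n × Fin p → ℝ := fun j =>
    (directMat d).col j.succ - b • (carryMat d).col j.succ with hs
  have hres : ∀ i, carryResidual d ((centMat t).col i) (Fin.cons 0 (b • (centMat t).col i)) =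
      s i - (1 / (t : ℝ)) • ∑ j, s j := by
    intro i
    rw [carryResidual_smul, centMat_col, Finset.smul_sum]
    simp only [Pi.sub_apply, sub_smul, Finset.sum_sub_distrib, Pi.single_apply, ite_smul,
      one_smul, zero_smul, Finset.sum_ite_eq', Finset.mem_univ, if_true, hs]
  refine (Finset.sum_le_sum fun i _ => dotProduct_infoContrast_le d ((centMat t).col i)
    (Fin.cons 0 (b • (centMat t).col i))).trans ?_
  simp only [hres]
  rw [sum_form_sub_mean _ ht]
  have hsum : ∑ j, s j = 1 - (directMat d).col 0 - b • carryTestVec d := by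
    simp only [hs, Finset.sum_sub_distrib, ← Finset.smul_sum, sum_directMat_test,
      sum_carryMat_test, carryTestVec]
  have hB := withinForm_directControl_carryTestVec hp0 d
  have hB' := (withinForm_comm (carryTestVec d) ((directMat d).col 0)).trans hB
  have hct : withinForm n p (carryTestVec d) (carryTestVec d) = gramTest d := rfl
  have hFF := sum_withinForm_carry_carry_le hp0 d
  have hTF := sum_withinForm_direct_carry hp0 d
  have hsq := mul_le_mul_of_nonneg_left hFF (sq_nonneg b)
  have hFT : ∀ j : Fin t, withinForm n p ((carryMat d).col j.succ) ((directMat d).col j.succ) =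
      withinForm n p ((directMat d).col j.succ) ((carryMat d).col j.succ) := fun j =>
    withinForm_comm _ _
  rw [hsum]
  simp only [hs, map_sub, map_smul, LinearMap.sub_apply, LinearMap.smul_apply, smul_eq_mul,
    withinForm_one hp0, withinForm_one_left hp0, hB, hB', hct, Finset.sum_sub_distrib,
    ← Finset.mul_sum, hFT, hTF]
  have e1 : X ^ 2 / slopeGram d = b * X := by
    rw [hb]
    ring
  have e2 : b * slopeGram d = X := div_mul_cancel₀ X hgram.ne'
  rw [e1]
  rw [slopeGram] at e2
  linear_combination hsq + b * e2 + 2 * b * hX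

/-- A nonsingular positive semidefinite `M_d` is positive definite, so both traces are positive, and
`x0`, `y0` inherit positivity from the bounds. -/
theorem infoContrast_bound (hp : 3 ≤ p) (hpt : p ≤ t + 1) (d : Design t n p)
    (hpos : 0 < repTilde d 0) (hlt : repTilde d 0 < n * (p - 1))
    (hu : IsUnit (infoContrast d)) :
    0 < x0 d ∧ 0 < y0 d ∧ ((t : ℝ) - 1) / x0 d + 1 / y0 d ≤ (infoContrast d)⁻¹.trace := by
  have ht : t ≠ 0 := by omega
  have ht2 : (2 : ℝ) ≤ t := by exact_mod_cast (by omega : 2 ≤ t)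
  have hM : (infoContrast d).PosDef := (infoMatrix_posSemidef _ _).posDef_iff_isUnit.mpr hu
  have hx := trace_infoContrast_mul_centMat_le hp hpt d hlt
  have hy := trace_infoContrast_mul_avgMat_le hp ht d hpos hlt
  have i0 : Fin t := ⟨0, by omega⟩
  have hy0 : 0 < y0 d := by
    refine lt_of_lt_of_le ?_ hy
    rw [trace_mul_avgMat]
    have h1 : (1 : Fin t → ℝ) ≠ 0 := fun h => one_ne_zero (congrFun h i0)
    have := hM.dotProduct_mulVec_pos h1
    rw [star_trivial] at this
    positivity
  have hx0 : 0 < x0 d := by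
    refine pos_of_mul_pos_right (lt_of_lt_of_le ?_ hx) (by linarith)
    rw [trace_mul_centMat ht]
    refine Finset.sum_pos (fun i _ => ?_) ⟨i0, Finset.mem_univ _⟩
    have h1 : (centMat t).col i ≠ 0 := fun h => by
      have := congrFun h i
      simp only [centMat_col, Pi.sub_apply, Pi.single_eq_same, Pi.zero_apply] at this
      have h2 : 1 / (t : ℝ) ≤ 1 / 2 := one_div_le_one_div_of_le two_pos ht2
      linarith
    have := hM.dotProduct_mulVec_pos h1
    rwa [star_trivial] at this
  exact ⟨hx0, hy0, le_trace_inv ht hM hx0 hy0 hx hy⟩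

/-! ### Tools for the case of equality. -/

theorem transpose_mul_prPerp_mul_apply {κ κ' : Type*} (X : Matrix (Fin n × Fin p) κ ℝ)
    (Y : Matrix (Fin n × Fin p) κ' ℝ) (i : κ) (j : κ') :
    (Xᵀ * prPerp (unitMat n p) * Y) i j = withinForm n p (X.col i) (Y.col j) := by
  rw [withinForm_apply, Matrix.mul_assoc]
  rfl

theorem TestInvariant.transpose {A : Matrix (Fin (t + 1)) (Fin (t + 1)) ℝ}
    (hA : TestInvariant A) : TestInvariant Aᵀ := fun σ hσ => by
  rw [← Matrix.transpose_submatrix, hA σ hσ]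

theorem TestInvariant.sum_mul_zero {A : Matrix (Fin (t + 1)) (Fin (t + 1)) ℝ}
    (hA : TestInvariant A) {z : Fin t → ℝ} (hz : ∑ i, z i = 0) :
    ∑ j : Fin t, z j * A 0 j.succ = 0 := by
  rcases isEmpty_or_nonempty (Fin t) with h | ⟨⟨i⟩⟩
  · simp
  · rw [Finset.sum_congr rfl fun j _ => by rw [hA.zero_left j i], ← Finset.sum_mul, hz, zero_mul]

theorem withinForm_lag_eq_zero {f : Fin n × Fin p → ℝ}
    (h : ∀ k, withinForm n p ((periodMat n p).col k) f = 0) : withinForm n p (lagVec n p) f = 0 := by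
  simp only [lagVec_eq_sum_period, map_sum, map_smul, LinearMap.sum_apply, LinearMap.smul_apply, h,
    smul_zero, Finset.sum_const_zero]

theorem sum_sum_withinForm (f g : Fin t → Fin n × Fin p → ℝ) :
    ∑ i, ∑ j, withinForm n p (f i) (g j) = withinForm n p (∑ i, f i) (∑ j, g j) := by
  simp only [map_sum, LinearMap.sum_apply]
  exact Finset.sum_comm

/-! ### Designs that are uniform over the periods -/

section Uniform

variable {d : Design t n p}
  (hl : ∀ (i : Fin (t + 1)) (k : Fin p), (lIK d i k : ℝ) = (rep d i : ℝ) / (p : ℝ))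

include hl

theorem withinForm_period_direct (hp : p ≠ 0) (k : Fin p) (i : Fin (t + 1)) :
    withinForm n p ((periodMat n p).col k) ((directMat d).col i) = 0 := by
  simp only [withinForm_period hp, Matrix.col_apply, sum_unit_directMat, sum_period_directMat,
    sum_nIU, hl]
  ring

theorem sum_unit_carryMat (k : Fin p) (i : Fin (t + 1)) :
    ∑ u, carryMat d (u, k) i = (rep d i : ℝ) / p * if 0 < k.val then 1 else 0 := by
  rcases Nat.eq_zero_or_pos k.val with hk | hk
  · simp [carryMat_of_val_eq_zero d _ hk, hk]
  · have h : (⟨k.val - 1, by omega⟩ : Fin p).val + 1 = k.val := Nat.sub_add_cancel hk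
    simp only [carryMat_of_succ d _ h, sum_unit_directMat, hl, if_pos hk, mul_one]

theorem repTilde_eq (hp : p ≠ 0) (i : Fin (t + 1)) :
    (repTilde d i : ℝ) = (rep d i : ℝ) / p * ((p : ℝ) - 1) := by
  rw [← sum_nTilde]
  simp only [← sum_period_carryMat]
  rw [Finset.sum_comm]
  simp only [sum_unit_carryMat hl, ← Finset.mul_sum]
  congr 1
  obtain ⟨m, rfl⟩ := Nat.exists_eq_succ_of_ne_zero hp
  rw [Fin.sum_univ_succ]
  simp

theorem withinForm_period_carry (hp : p ≠ 0) (k : Fin p) (i : Fin (t + 1)) :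
    withinForm n p ((periodMat n p).col k) ((carryMat d).col i) =
      (rep d i : ℝ) / p * ((if 0 < k.val then 1 else 0) - ((p : ℝ) - 1) / p) := by
  simp only [withinForm_period hp, Matrix.col_apply, sum_unit_carryMat hl, sum_period_carryMat,
    sum_nTilde, repTilde_eq hl hp]
  ring

theorem withinForm_lag_direct (hp : p ≠ 0) (i : Fin (t + 1)) :
    withinForm n p (lagVec n p) ((directMat d).col i) = 0 :=
  withinForm_lag_eq_zero fun k => withinForm_period_direct hl hp k i

end Uniform

theorem withinForm_period_lag (hp : p ≠ 0) (k : Fin p) :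
    withinForm n p ((periodMat n p).col k) (lagVec n p) =
      (n : ℝ) * ((if 0 < k.val then 1 else 0) - ((p : ℝ) - 1) / p) := by
  simp only [withinForm_period hp, sum_lagVec hp]
  have h : ∑ u, lagVec n p (u, k) = n * if 0 < k.val then 1 else 0 :=
    (Finset.sum_const (s := (Finset.univ : Finset (Fin n))) (if 0 < k.val then (1 : ℝ) else 0)).trans
      (by rw [Finset.card_univ, Fintype.card_fin, nsmul_eq_mul])
  rw [h, Finset.sum_const, Finset.card_univ, Fintype.card_fin, nsmul_eq_mul]
  ring

/-- If all values are equal, each is the mean. -/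
theorem mul_eq_sum_of_const {f : Fin t → ℝ} (h : ∀ i j, f i = f j) (i : Fin t) :
    (t : ℝ) * f i = ∑ j, f j := by
  rw [Finset.sum_congr rfl fun j _ => h j i]
  simp

/-! ### Symmetric designs -/

section Symmetric

variable {d : Design t n p}
  (hl : ∀ (i : Fin (t + 1)) (k : Fin p), (lIK d i k : ℝ) = (rep d i : ℝ) / (p : ℝ))
  (hTT : TestInvariant ((directMat d)ᵀ * prPerp (unitMat n p) * directMat d))
  (hTF : TestInvariant ((directMat d)ᵀ * prPerp (unitMat n p) * carryMat d))
  (hFF : TestInvariant ((carryMat d)ᵀ * prPerp (unitMat n p) * carryMat d))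
  (h1 : ∀ i : Fin (t + 1), i ≠ 0 → ∀ u, nTilde d i u ≤ 1)

include hTF in
theorem carryDirect_invariant :
    TestInvariant ((carryMat d)ᵀ * prPerp (unitMat n p) * directMat d) := by
  have := hTF.transpose
  rwa [Matrix.transpose_mul, Matrix.transpose_mul, Matrix.transpose_transpose, prPerp_transpose,
    ← Matrix.mul_assoc] at this

include hFF h1 in
-- Without repetitions the diagonal entries of `F' pr^⊥(U) F` are `(1 - 1/p) r̃_i`, and invariance
-- makes them equal.
theorem repTilde_test_eq (hp : 2 ≤ p) (i j : Fin t) :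
    (repTilde d i.succ : ℝ) = repTilde d j.succ := by
  have hp0 : p ≠ 0 := by omega
  have hp2 : (2 : ℝ) ≤ p := by exact_mod_cast hp
  have h := hFF.diag i j
  simp only [transpose_mul_prPerp_mul_apply, withinForm_carry_carry hp0] at h
  rw [sum_sq_eq_repTilde d (h1 _ (Fin.succ_ne_zero i)),
    sum_sq_eq_repTilde d (h1 _ (Fin.succ_ne_zero j))] at h
  have hc : 1 - 1 / (p : ℝ) ≠ 0 := by
    have : 1 / (p : ℝ) ≤ 1 / 2 := one_div_le_one_div_of_le two_pos hp2
    linarith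
  exact mul_left_cancel₀ hc (by linarith)

include hl hFF h1 in
theorem rep_test_eq (hp : 2 ≤ p) (i j : Fin t) :
    (rep d i.succ : ℝ) / p = (rep d j.succ : ℝ) / p := by
  have hp0 : p ≠ 0 := by omega
  have hp2 : (2 : ℝ) ≤ p := by exact_mod_cast hp
  have h := repTilde_test_eq hFF h1 hp i j
  rw [repTilde_eq hl hp0, repTilde_eq hl hp0] at h
  exact mul_right_cancel₀ (by linarith) h

include hl hTT hTF hFF h1 in
-- By invariance each block acts as a scalar on zero-sum vectors, so the slope from the bound solves
-- the carryover equations exactly. The period equations hold because the test treatments are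
-- equally replicated.
theorem infoContrast_mulVec_of_sum_eq_zero (hp : 3 ≤ p) (hpt : p ≤ t + 1)
    (hlt : repTilde d 0 < n * (p - 1)) {z : Fin t → ℝ} (hz : ∑ i, z i = 0) :
    infoContrast d *ᵥ z = x0 d • z := by
  have hp0 : p ≠ 0 := by omega
  have ht : t ≠ 0 := by omega
  have ht1 : (0 : ℝ) < (t : ℝ) - 1 := by
    have : (2 : ℝ) ≤ t := by exact_mod_cast (by omega : 2 ≤ t)
    linarith
  have hgram := slopeGram_pos hp hpt d hlt
  have hFT := carryDirect_invariant hTF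
  set X := carryTest d + 1 / (t : ℝ) * carryMixed d with hX
  have hB := withinForm_directControl_carryTestVec hp0 d
  have eTT : ∀ i, ((t : ℝ) - 1) * ∑ j : Fin t, z j *
      withinForm n p ((directMat d).col i.succ) ((directMat d).col j.succ) =
        (∑ j : Fin t, withinForm n p ((directMat d).col j.succ) ((directMat d).col j.succ) -
          1 / (t : ℝ) * withinForm n p ((directMat d).col 0) ((directMat d).col 0)) * z i := by
    intro i
    have := hTT.sum_mul (by omega) hz i
    simp only [transpose_mul_prPerp_mul_apply, sum_sum_withinForm (fun j : Fin t =>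
      (directMat d).col j.succ), sum_directMat_test, map_sub, LinearMap.sub_apply,
      withinForm_one hp0, withinForm_one_left hp0] at this
    rw [this]
    ring
  have eTF : ∀ i, ((t : ℝ) - 1) * ∑ j : Fin t, z j *
      withinForm n p ((directMat d).col i.succ) ((carryMat d).col j.succ) = X * z i := by
    intro i
    have := hTF.sum_mul (by omega) hz i
    simp only [transpose_mul_prPerp_mul_apply, sum_sum_withinForm (fun j : Fin t =>
      (directMat d).col j.succ) (fun j : Fin t => (carryMat d).col j.succ)] at this
    rw [this, sum_withinForm_direct_carry hp0, sum_directMat_test, sum_carryMat_test,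
      ← carryTestVec, map_sub, LinearMap.sub_apply, withinForm_one_left hp0, hB, hX]
    ring
  have eFT : ∀ i, ((t : ℝ) - 1) * ∑ j : Fin t, z j *
      withinForm n p ((carryMat d).col i.succ) ((directMat d).col j.succ) = X * z i := by
    intro i
    have := hFT.sum_mul (by omega) hz i
    simp only [transpose_mul_prPerp_mul_apply, sum_sum_withinForm (fun j : Fin t =>
      (carryMat d).col j.succ) (fun j : Fin t => (directMat d).col j.succ)] at this
    rw [this, withinForm_comm (∑ j : Fin t, (carryMat d).col j.succ), sum_directMat_test,
      sum_carryMat_test, ← carryTestVec, map_sub, LinearMap.sub_apply, withinForm_one_left hp0, hB,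
      hX, ← sum_withinForm_direct_carry hp0,
      Finset.sum_congr rfl fun j _ => withinForm_comm ((carryMat d).col j.succ) _]
    ring
  have eFF : ∀ i, ((t : ℝ) - 1) * ∑ j : Fin t, z j *
      withinForm n p ((carryMat d).col i.succ) ((carryMat d).col j.succ) =
        slopeGram d * z i := by
    intro i
    have := hFF.sum_mul (by omega) hz i
    simp only [transpose_mul_prPerp_mul_apply, sum_sum_withinForm (fun j : Fin t =>
      (carryMat d).col j.succ) (fun j : Fin t => (carryMat d).col j.succ)] at this
    rw [this, sum_withinForm_carry_carry hp0 d h1, sum_carryMat_test, ← carryTestVec, ← gramTest,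
      ← slopeGram]
  set b := X / slopeGram d with hb
  have hform : ∀ f, withinForm n p f (carryResidual d z (Fin.cons 0 (b • z))) =
      ∑ j : Fin t, z j * withinForm n p f ((directMat d).col j.succ) -
        b * ∑ j : Fin t, z j * withinForm n p f ((carryMat d).col j.succ) := by
    intro f
    simp only [carryResidual_smul, map_sum, map_smul, map_sub, smul_eq_mul, mul_sub,
      Finset.sum_sub_distrib, Finset.mul_sum, mul_left_comm b]
  ext i
  rw [infoContrast_mulVec_apply d z (Fin.cons 0 (b • z)), hform, Pi.smul_apply, smul_eq_mul]
  · refine mul_left_cancel₀ ht1.ne' ?_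
    have e := x0_eq hp0 (by omega : 2 ≤ t) d
    have e1 : X ^ 2 / slopeGram d = b * X := by
      rw [hb]
      ring
    rw [← hX, e1] at e
    linear_combination eTT i - b * eTF i - z i * e
  · intro k
    rw [hform]
    have h2 : ∑ j : Fin t, z j * withinForm n p ((periodMat n p).col k)
        ((carryMat d).col j.succ) = 0 := by
      simp only [withinForm_period_carry hl hp0]
      rw [Finset.sum_congr rfl fun j _ => by
        rw [rep_test_eq hl hFF h1 (by omega) j ⟨0, by omega⟩], ← Finset.sum_mul, hz, zero_mul]
    simp [withinForm_period_direct hl hp0, h2]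
  · intro i'
    rw [hform]
    refine Fin.cases ?_ (fun i => ?_) i'
    · have e1 := hFT.sum_mul_zero hz
      have e2 := hFF.sum_mul_zero hz
      simp only [transpose_mul_prPerp_mul_apply] at e1 e2
      rw [e1, e2, mul_zero, sub_zero]
    · refine mul_left_cancel₀ ht1.ne' ?_
      have e2 : b * slopeGram d = X := div_mul_cancel₀ X hgram.ne'
      linear_combination eFT i - b * eFF i - z i * e2

include hl hTT hTF hFF h1 in
theorem infoContrast_mulVec_one (hp : 3 ≤ p) (ht : t ≠ 0)
    (hpos : 0 < repTilde d 0) (hlt : repTilde d 0 < n * (p - 1)) :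
    infoContrast d *ᵥ 1 = y0 d • 1 := by
  have hp0 : p ≠ 0 := by omega
  have hp' : (0 : ℝ) < p := Nat.cast_pos.mpr (by omega)
  have ht' : (0 : ℝ) < t := Nat.cast_pos.mpr (Nat.pos_of_ne_zero ht)
  have hN : 0 < (n : ℝ) * ((p : ℝ) - 1) := by
    have := Nat.cast_pos (α := ℝ).mpr (hpos.trans hlt)
    rwa [Nat.cast_mul, Nat.cast_sub (by omega), Nat.cast_one] at this
  have hp1 : (p : ℝ) - 1 ≠ 0 := (mul_ne_zero_iff.mp hN.ne').2
  have hn0 : (n : ℝ) ≠ 0 := (mul_ne_zero_iff.mp hN.ne').1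
  have hdet := gram_det_pos hp d hpos hlt
  have hFT := carryDirect_invariant hTF
  -- Chosen so that `F_0 - c * lagVec` is orthogonal to the periods under the within-unit form;
  -- `lagVec` is the sum of all carryover columns, so this vector is still an admissible fit.
  set c := (repTilde d 0 : ℝ) / (n * ((p : ℝ) - 1)) with hc
  set E := gramControl d - c * (repTilde d 0 / (p : ℝ)) with hE
  have hdetE : gramControl d * gramTest d - gramMixed d ^ 2 = E * (n * ((p : ℝ) - 1) / p) := by
    rw [hE, hc, gramTest_eq hp0, gramMixed_eq hp0]
    field_simp
    ring
  have hE0 : E ≠ 0 := fun h => by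
    rw [hdetE, h, zero_mul] at hdet
    exact hdet.false
  -- Solves the normal equation of the control carryover, `E` being the form of `F_0` with `F_0 - c
  -- * lagVec`.
  set a := -(carryControl d / E) with ha
  set w : Fin (t + 1) → ℝ := Fin.cons (a * (1 - c)) fun _ => -(a * c) with hw
  have hform : ∀ f, withinForm n p f (carryResidual d 1 w) =
      -withinForm n p f ((directMat d).col 0) -
        a * (withinForm n p f ((carryMat d).col 0) - c * withinForm n p f (lagVec n p)) := by
    intro f
    rw [hw, carryResidual_const, carryTestVec]
    simp only [map_sub, map_add, map_smul, smul_eq_mul, withinForm_one hp0]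
    ring
  have hP : ∀ k, withinForm n p ((periodMat n p).col k) (carryResidual d 1 w) = 0 := by
    intro k
    rw [hform, withinForm_period_direct hl hp0, withinForm_period_carry hl hp0,
      withinForm_period_lag hp0]
    have : (rep d 0 : ℝ) / p = c * n := by
      rw [hc, repTilde_eq hl hp0]
      field_simp
    rw [this]
    ring
  have hJ : withinForm n p (lagVec n p) (carryResidual d 1 w) = 0 :=
    withinForm_lag_eq_zero hP
  have hG := withinForm_directControl_carryControl hp0 d
  have hF0 : withinForm n p ((carryMat d).col 0) (carryResidual d 1 w) = 0 := by
    have hcc : withinForm n p ((carryMat d).col 0) ((carryMat d).col 0) = gramControl d := rfl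
    rw [hform, withinForm_comm _ ((directMat d).col 0), hG, withinForm_carry_lag hp0, hcc, ← hE,
      ha]
    field_simp
    ring
  have hTlag : ∀ i, withinForm n p ((directMat d).col i) (lagVec n p) = 0 := fun i => by
    rw [withinForm_comm, withinForm_lag_direct hl hp0]
  -- Period uniformity makes `G + B = 0`, which removes the slack in the bound by `y0`.
  have hGB : carryMixed d = -carryControl d := by
    rw [← withinForm_directControl_carryTestVec hp0, carryTestVec, map_sub, hTlag, hG, zero_sub]
  ext i
  rw [infoContrast_mulVec_apply d 1 w hP]
  · have hconst : ∀ i j : Fin t, withinForm n p ((directMat d).col i.succ) (carryResidual d 1 w) =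
        withinForm n p ((directMat d).col j.succ) (carryResidual d 1 w) := by
      intro i j
      have e1 := hTT.zero_right i j
      have e2 := hTF.zero_right i j
      simp only [transpose_mul_prPerp_mul_apply] at e1 e2
      rw [hform, hform, e1, e2, hTlag, hTlag]
    have hmean := mul_eq_sum_of_const hconst i
    rw [← LinearMap.sum_apply, ← map_sum, sum_directMat_test, map_sub, LinearMap.sub_apply,
      withinForm_one_left hp0, hform ((directMat d).col 0), hTlag, hG] at hmean
    refine mul_left_cancel₀ ht'.ne' (hmean.trans ?_)
    rw [Pi.smul_apply, Pi.one_apply, smul_eq_mul, mul_one, y0_eq hp0 ht, hdetE, hGB, ha]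
    have e : gramTest d + gramMixed d + (gramControl d + gramMixed d) =
        n * ((p : ℝ) - 1) / p := by
      rw [gramTest_eq hp0, gramMixed_eq hp0]
      ring
    have e' : (gramTest d + gramMixed d) * carryControl d ^ 2 +
        (gramControl d + gramMixed d) * (-carryControl d) ^ 2 =
          n * ((p : ℝ) - 1) / p * carryControl d ^ 2 := by
      rw [← e]
      ring
    rw [e']
    field_simp
    ring
  · intro i'
    refine Fin.cases hF0 (fun i => ?_) i'
    -- The test equations all have the same left side, and these sum to zero because `lagVec` and
    -- `F_0` are already orthogonal to the residual.
    have hconst : ∀ i j : Fin t, withinForm n p ((carryMat d).col i.succ) (carryResidual d 1 w) =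
        withinForm n p ((carryMat d).col j.succ) (carryResidual d 1 w) := by
      intro i j
      have e1 := hFT.zero_right i j
      have e2 := hFF.zero_right i j
      simp only [transpose_mul_prPerp_mul_apply] at e1 e2
      rw [hform, hform, e1, e2, withinForm_carry_lag hp0, withinForm_carry_lag hp0,
        repTilde_test_eq hFF h1 (by omega) i j]
    have hmean := mul_eq_sum_of_const hconst i
    rw [← LinearMap.sum_apply, ← map_sum, sum_carryMat_test, map_sub, LinearMap.sub_apply, hJ, hF0,
      sub_zero] at hmean
    exact (mul_eq_zero.mp hmean).resolve_left ht'.ne'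

end Symmetric

end Crossover

theorem lemma4 (t n p : ℕ) (hp : 3 ≤ p) (hpt : p ≤ t + 1) (d : Crossover.Design t n p)
    (hpos : 0 < Crossover.repTilde d 0) (hlt : Crossover.repTilde d 0 < n * (p - 1)) :
    (IsUnit (Crossover.infoContrast d) →
      0 < Crossover.x0 d ∧ 0 < Crossover.y0 d ∧
      ((t : ℝ) - 1) / Crossover.x0 d + 1 / Crossover.y0 d ≤
        (Crossover.infoContrast d)⁻¹.trace) ∧
    ((∀ (i : Fin (t + 1)) (k : Fin p),
        (Crossover.lIK d i k : ℝ) = (Crossover.rep d i : ℝ) / (p : ℝ)) →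
      Crossover.TestInvariant
        ((Crossover.directMat d)ᵀ * Crossover.prPerp (Crossover.unitMat n p) *
          Crossover.directMat d) →
      Crossover.TestInvariant
        ((Crossover.directMat d)ᵀ * Crossover.prPerp (Crossover.unitMat n p) *
          Crossover.carryMat d) →
      Crossover.TestInvariant
        ((Crossover.carryMat d)ᵀ * Crossover.prPerp (Crossover.unitMat n p) *
          Crossover.carryMat d) →
      (∀ i : Fin (t + 1), i ≠ 0 → ∀ u : Fin n, Crossover.nTilde d i u ≤ 1) →
      (IsUnit (Crossover.infoContrast d) ↔ 0 < Crossover.x0 d ∧ 0 < Crossover.y0 d) ∧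
      (IsUnit (Crossover.infoContrast d) →
        (Crossover.infoContrast d)⁻¹.trace =
          ((t : ℝ) - 1) / Crossover.x0 d + 1 / Crossover.y0 d)) := by
  have hbound := Crossover.infoContrast_bound hp hpt d hpos hlt
  refine ⟨hbound, fun hl hTT hTF hFF h1 => ?_⟩
  have ht : t ≠ 0 := by omega
  have hM := Crossover.eq_smul_centMat_add ht
    (fun z hz => Crossover.infoContrast_mulVec_of_sum_eq_zero hl hTT hTF hFF h1 hp hpt hlt hz)
    (Crossover.infoContrast_mulVec_one hl hTT hTF hFF h1 hp ht hpos hlt)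
  refine ⟨⟨fun hu => ⟨(hbound hu).1, (hbound hu).2.1⟩, fun ⟨hx, hy⟩ => ?_⟩, fun hu => ?_⟩
  · rw [hM]
    exact IsUnit.of_mul_eq_one _ (Crossover.smul_centMat_add_mul ht hx.ne' hy.ne')
  · obtain ⟨hx, hy, -⟩ := hbound hu
    nth_rewrite 1 [hM]
    exact Crossover.trace_inv_smul_centMat_add ht hx.ne' hy.ne'
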